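/- Let $N\ge 1$, $s\in(0,1)$, $m>0$, $T>0$, $\omega=2\pi/T$, and $\mathcal S_T=(0,T)^N\times(0,\infty)$. Let $\mathbb X^s_{m,T}$ be the completion of the space of real functions $v(x,y)$ that are $C^\infty$ on the closed half-space $\{(x,y)\in\mathbb R^N\times\mathbb R: y\ge 0\}$, $T$-periodic in each $x_i$, and have finite norm $$\|v\|_{\mathbb X^s_{m,T}}=\Big(\iint_{\mathcal S_T} y^{1-2s}\big(|\nabla v|^2+m^2v^2\big)\,dx\,dy\Big)^{1/2},$$ and let $\mathrm{Tr}$ be the continuous extension to $\mathbb X^s_{m,T}$ of the restriction $v\mapsto v(\cdot,0)\in L^2((0,T)^N)$. Let $\mathbb H^s_{m,T}$ be the space of real $u\in L^2((0,T)^N)$ with $$|u|_{\mathbb H^s_{m,T}}=\Big(\sum_{k\in\mathbb Z^N}(\omega^2|k|^2+m^2)^s|c_k|^2\Big)^{1/2}<\infty,\qquad c_k=\frac1{\sqrt{T^N}}\int_{(0,T)^N}u(x)e^{-i\omega k\cdot x}\,dx .$$ Assume $N>2s$. Then $\mathrm{Tr}(\mathbb X^s_{m,T})=\mathbb H^s_{m,T}$,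 the map $\mathrm{Tr}:\mathbb X^s_{m,T}\to\mathbb H^s_{m,T}$ is bounded, and $\mathrm{Tr}(\mathbb X^s_{m,T})$, with the norm $|\cdot|_{\mathbb H^s_{m,T}}$, is continuously embedded in $L^q((0,T)^N)$ for every real $q$ with $1\le q\le \frac{2N}{N-2s}$: there is $C>0$ with $|u|_{L^q((0,T)^N)}\le C|u|_{\mathbb H^s_{m,T}}$ for all $u\in\mathrm{Tr}(\mathbb X^s_{m,T})$. For every real $q$ with $1\le q<\frac{2N}{N-2s}$ this embedding is compact: every sequence in $\mathrm{Tr}(\mathbb X^s_{m,T})$ that is bounded in $\mathbb H^s_{m,T}$ has a subsequence converging in $L^q((0,T)^N)$. -/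

import Mathlib

open MeasureTheory Set Filter Topology
open scoped ENNReal ContDiff

namespace PeriodicExt

/-- The cube `(0,T)^N`. -/
def cell (N : ℕ) (T : ℝ) : Set (EuclideanSpace ℝ (Fin N)) :=
  {x | ∀ i, x i ∈ Ioo 0 T}

/-- The half-cylinder `(0,T)^N × (0,∞)`; its points are pairs `(x, y)`. -/
def halfCylinder (N : ℕ) (T : ℝ) : Set (EuclideanSpace ℝ (Fin N) × ℝ) :=
  cell N T ×ˢ Ioi 0

/-- The partial derivative with respect to `x_i`. -/
noncomputable def dx {N : ℕ} (i : Fin N) (v : EuclideanSpace ℝ (Fin N) × ℝ → ℝ)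
    (p : EuclideanSpace ℝ (Fin N) × ℝ) : ℝ :=
  fderiv ℝ v p (EuclideanSpace.single i 1, 0)

/-- The partial derivative with respect to `y`. -/
noncomputable def dy {N : ℕ} (v : EuclideanSpace ℝ (Fin N) × ℝ → ℝ)
    (p : EuclideanSpace ℝ (Fin N) × ℝ) : ℝ :=
  fderiv ℝ v p (0, 1)

/-- The integrand `y^(1-2s) (∇v · ∇w + m² v w)`. -/
noncomputable def energyDensity {N : ℕ} (s m : ℝ) (v w : EuclideanSpace ℝ (Fin N) × ℝ → ℝ)
    (p : EuclideanSpace ℝ (Fin N) × ℝ) : ℝ :=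
  p.2 ^ (1 - 2 * s) *
    ((∑ i, dx i v p * dx i w p) + dy v p * dy w p + m ^ 2 * (v p * w p))

/-- Functions that are smooth on the closed half-space `y ≥ 0` and `T`-periodic in each `x_i`. -/
structure SmoothPeriodic {N : ℕ} (T : ℝ) (v : EuclideanSpace ℝ (Fin N) × ℝ → ℝ) : Prop where
  contDiffOn : ContDiffOn ℝ ∞ v {p | 0 ≤ p.2}
  periodic : ∀ (i : Fin N) (x : EuclideanSpace ℝ (Fin N)) (y : ℝ), 0 ≤ y →
    v (x + EuclideanSpace.single i T, y) = v (x, y)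

theorem isOpen_cell (N : ℕ) (T : ℝ) : IsOpen (cell N T) := by
  have : cell N T = ⋂ i : Fin N, {x : EuclideanSpace ℝ (Fin N) | x i ∈ Ioo 0 T} := by
    ext x; simp [cell]
  rw [this]
  exact isOpen_iInter_of_finite fun i => isOpen_Ioo.preimage (by fun_prop)

theorem isOpen_halfCylinder (N : ℕ) (T : ℝ) : IsOpen (halfCylinder N T) :=
  (isOpen_cell N T).prod isOpen_Ioi

theorem SmoothPeriodic.contDiffOn_upper {N : ℕ} {T : ℝ} {v : EuclideanSpace ℝ (Fin N) × ℝ → ℝ}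
    (hv : SmoothPeriodic T v) : ContDiffOn ℝ ∞ v {p | 0 < p.2} :=
  hv.contDiffOn.mono fun p (hp : 0 < p.2) => hp.le

theorem isOpen_upper (N : ℕ) : IsOpen {p : EuclideanSpace ℝ (Fin N) × ℝ | 0 < p.2} :=
  isOpen_lt continuous_const continuous_snd

theorem SmoothPeriodic.differentiableAt {N : ℕ} {T : ℝ} {v : EuclideanSpace ℝ (Fin N) × ℝ → ℝ}
    (hv : SmoothPeriodic T v) {p : EuclideanSpace ℝ (Fin N) × ℝ} (hp : 0 < p.2) :
    DifferentiableAt ℝ v p :=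
  (hv.contDiffOn_upper.contDiffAt ((isOpen_upper N).mem_nhds hp)).differentiableAt (by simp)

theorem SmoothPeriodic.continuousOn_fderiv {N : ℕ} {T : ℝ}
    {v : EuclideanSpace ℝ (Fin N) × ℝ → ℝ} (hv : SmoothPeriodic T v) :
    ContinuousOn (fderiv ℝ v) {p | 0 < p.2} :=
  hv.contDiffOn_upper.continuousOn_fderiv_of_isOpen (isOpen_upper N) (by simp)

theorem SmoothPeriodic.aestronglyMeasurable {N : ℕ} {s m T : ℝ}
    {v w : EuclideanSpace ℝ (Fin N) × ℝ → ℝ} (hv : SmoothPeriodic T v) (hw : SmoothPeriodic T w) :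
    AEStronglyMeasurable (energyDensity s m v w) (volume.restrict (halfCylinder N T)) := by
  have hsub : halfCylinder N T ⊆ {p | 0 < p.2} := fun p hp => hp.2
  refine ContinuousOn.aestronglyMeasurable (ContinuousOn.mono ?_ hsub)
    (isOpen_halfCylinder N T).measurableSet
  have h1 := hv.continuousOn_fderiv
  have h2 := hw.continuousOn_fderiv
  have h3 := hv.contDiffOn_upper.continuousOn
  have h4 := hw.contDiffOn_upper.continuousOn
  unfold energyDensity dx dy
  refine ContinuousOn.mul ?_ (((continuousOn_finsetSum _ fun i _ => ?_).add ?_).add ?_)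
  · exact continuousOn_snd.rpow_const fun p hp => Or.inl (ne_of_gt hp)
  · exact (h1.clm_apply continuousOn_const).mul (h2.clm_apply continuousOn_const)
  · exact (h1.clm_apply continuousOn_const).mul (h2.clm_apply continuousOn_const)
  · exact continuousOn_const.mul (h3.mul h4)

theorem dx_add {N : ℕ} {v w : EuclideanSpace ℝ (Fin N) × ℝ → ℝ}
    {p : EuclideanSpace ℝ (Fin N) × ℝ} (hv : DifferentiableAt ℝ v p)
    (hw : DifferentiableAt ℝ w p) (i : Fin N) : dx i (v + w) p = dx i v p + dx i w p := by
  simp [dx, fderiv_add hv hw]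

theorem dy_add {N : ℕ} {v w : EuclideanSpace ℝ (Fin N) × ℝ → ℝ}
    {p : EuclideanSpace ℝ (Fin N) × ℝ} (hv : DifferentiableAt ℝ v p)
    (hw : DifferentiableAt ℝ w p) : dy (v + w) p = dy v p + dy w p := by
  simp [dy, fderiv_add hv hw]

theorem dx_smul {N : ℕ} (c : ℝ) (v : EuclideanSpace ℝ (Fin N) × ℝ → ℝ)
    (p : EuclideanSpace ℝ (Fin N) × ℝ) (i : Fin N) : dx i (c • v) p = c * dx i v p := by
  simp [dx, fderiv_const_smul_field]

theorem dy_smul {N : ℕ} (c : ℝ) (v : EuclideanSpace ℝ (Fin N) × ℝ → ℝ)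
    (p : EuclideanSpace ℝ (Fin N) × ℝ) : dy (c • v) p = c * dy v p := by
  simp [dy, fderiv_const_smul_field]

theorem energyDensity_comm {N : ℕ} (s m : ℝ) (v w : EuclideanSpace ℝ (Fin N) × ℝ → ℝ)
    (p : EuclideanSpace ℝ (Fin N) × ℝ) : energyDensity s m v w p = energyDensity s m w v p := by
  simp only [energyDensity, mul_comm]

theorem energyDensity_add {N : ℕ} (s m : ℝ) {v w : EuclideanSpace ℝ (Fin N) × ℝ → ℝ}
    (z : EuclideanSpace ℝ (Fin N) × ℝ → ℝ) {p : EuclideanSpace ℝ (Fin N) × ℝ}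
    (hv : DifferentiableAt ℝ v p) (hw : DifferentiableAt ℝ w p) :
    energyDensity s m (v + w) z p = energyDensity s m v z p + energyDensity s m w z p := by
  simp only [energyDensity, dx_add hv hw, dy_add hv hw, Pi.add_apply, add_mul,
    Finset.sum_add_distrib]
  ring

theorem energyDensity_smul {N : ℕ} (s m c : ℝ) (v z : EuclideanSpace ℝ (Fin N) × ℝ → ℝ)
    (p : EuclideanSpace ℝ (Fin N) × ℝ) :
    energyDensity s m (c • v) z p = c * energyDensity s m v z p := by
  simp only [energyDensity, dx_smul, dy_smul, Pi.smul_apply, smul_eq_mul, mul_assoc,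
    ← Finset.mul_sum]
  ring

theorem energyDensity_self_nonneg {N : ℕ} (s m : ℝ) (v : EuclideanSpace ℝ (Fin N) × ℝ → ℝ)
    {p : EuclideanSpace ℝ (Fin N) × ℝ} (hp : 0 < p.2) : 0 ≤ energyDensity s m v v p := by
  have : 0 ≤ ∑ i, dx i v p * dx i v p := Finset.sum_nonneg fun i _ => mul_self_nonneg _
  unfold energyDensity
  have h2 := mul_self_nonneg (dy v p)
  have h3 := mul_self_nonneg (v p)
  positivity

theorem abs_energyDensity_le {N : ℕ} (s m : ℝ) (v w : EuclideanSpace ℝ (Fin N) × ℝ → ℝ)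
    {p : EuclideanSpace ℝ (Fin N) × ℝ} (hp : 0 < p.2) :
    |energyDensity s m v w p| ≤ energyDensity s m v v p + energyDensity s m w w p := by
  unfold energyDensity
  rw [← mul_add, abs_mul, abs_of_nonneg (Real.rpow_nonneg hp.le _)]
  refine mul_le_mul_of_nonneg_left ?_ (Real.rpow_nonneg hp.le _)
  have key : ∀ a b : ℝ, |a * b| ≤ a * a + b * b := fun a b => by
    rw [abs_le]; constructor <;> nlinarith [sq_nonneg (a + b), sq_nonneg (a - b)]
  have h1 : |∑ i, dx i v p * dx i w p| ≤
      (∑ i, dx i v p * dx i v p) + ∑ i, dx i w p * dx i w p := by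
    rw [← Finset.sum_add_distrib]
    exact (Finset.abs_sum_le_sum_abs _ _).trans (Finset.sum_le_sum fun i _ => key _ _)
  have h2 := key (dy v p) (dy w p)
  have h3 : |m ^ 2 * (v p * w p)| ≤ m ^ 2 * (v p * v p) + m ^ 2 * (w p * w p) := by
    rw [abs_mul, abs_of_nonneg (sq_nonneg m), ← mul_add]
    exact mul_le_mul_of_nonneg_left (key _ _) (sq_nonneg m)
  have h4 := abs_add_le ((∑ i, dx i v p * dx i w p) + dy v p * dy w p) (m ^ 2 * (v p * w p))
  have h5 := abs_add_le (∑ i, dx i v p * dx i w p) (dy v p * dy w p)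
  linarith

theorem SmoothPeriodic.integrableOn {N : ℕ} {s m T : ℝ}
    {v w : EuclideanSpace ℝ (Fin N) × ℝ → ℝ} (hv : SmoothPeriodic T v) (hw : SmoothPeriodic T w)
    (hvi : IntegrableOn (energyDensity s m v v) (halfCylinder N T))
    (hwi : IntegrableOn (energyDensity s m w w) (halfCylinder N T)) :
    IntegrableOn (energyDensity s m v w) (halfCylinder N T) := by
  refine Integrable.mono' (hvi.add hwi) (hv.aestronglyMeasurable hw) ?_
  refine (ae_restrict_iff' (isOpen_halfCylinder N T).measurableSet).2 (ae_of_all _ fun p hp => ?_)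
  exact abs_energyDensity_le s m v w hp.2

/-- The smooth periodic functions `v` on the closed half-space with
`∫∫ y^(1-2s) (|∇v|² + m² v²) < ∞`. -/
def testSpace (N : ℕ) (s m T : ℝ) : Submodule ℝ (EuclideanSpace ℝ (Fin N) × ℝ → ℝ) where
  carrier := {v | SmoothPeriodic T v ∧ IntegrableOn (energyDensity s m v v) (halfCylinder N T)}
  zero_mem' := by
    refine ⟨⟨contDiffOn_const, fun _ _ _ _ => rfl⟩, ?_⟩
    have : energyDensity s m (0 : EuclideanSpace ℝ (Fin N) × ℝ → ℝ) 0 = 0 := by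
      ext p; simp [energyDensity, dx, dy]
    rw [this]; exact integrableOn_zero
  add_mem' := by
    rintro v w ⟨hv, hvi⟩ ⟨hw, hwi⟩
    refine ⟨⟨hv.contDiffOn.add hw.contDiffOn, fun i x y hy => ?_⟩, ?_⟩
    · simp [hv.periodic i x y hy, hw.periodic i x y hy]
    · refine ((hvi.add (hv.integrableOn hw hvi hwi)).add
        ((hw.integrableOn hv hwi hvi).add hwi)).congr_fun ?_
        (isOpen_halfCylinder N T).measurableSet
      intro p hp
      have h1 := hv.differentiableAt (p := p) hp.2
      have h2 := hw.differentiableAt (p := p) hp.2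
      simp only [Pi.add_apply]
      rw [energyDensity_add s m _ h1 h2, energyDensity_comm s m v (v + w),
        energyDensity_comm s m w (v + w), energyDensity_add s m _ h1 h2,
        energyDensity_add s m _ h1 h2, energyDensity_comm s m w v]
  smul_mem' := by
    rintro c v ⟨hv, hvi⟩
    refine ⟨⟨contDiffOn_const.smul hv.contDiffOn, fun i x y hy => ?_⟩, ?_⟩
    · simp [hv.periodic i x y hy]
    · have : energyDensity s m (c • v) (c • v) = fun p => c * (c * energyDensity s m v v p) := by
        ext p
        rw [energyDensity_smul, energyDensity_comm, energyDensity_smul]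
      rw [this]
      exact (hvi.const_mul c).const_mul c

/-- `testSpace` as a type of its own, so that its only topology is the one given by the
seminorm below. -/
def TestFun (N : ℕ) (s m T : ℝ) : Type := testSpace N s m T

/-- The underlying function. -/
def TestFun.toFun {N : ℕ} {s m T : ℝ} (v : TestFun N s m T) :
    EuclideanSpace ℝ (Fin N) × ℝ → ℝ :=
  Subtype.val v

theorem TestFun.mem {N : ℕ} {s m T : ℝ} (v : TestFun N s m T) : v.toFun ∈ testSpace N s m T :=
  Subtype.property v

noncomputable instance (N : ℕ) (s m T : ℝ) : AddCommGroup (TestFun N s m T) :=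
  inferInstanceAs (AddCommGroup (testSpace N s m T))

noncomputable instance (N : ℕ) (s m T : ℝ) : Module ℝ (TestFun N s m T) :=
  inferInstanceAs (Module ℝ (testSpace N s m T))

/-- The inner product `∫∫ y^(1-2s) (∇v · ∇w + m² v w)` on `TestFun`. -/
@[reducible] noncomputable def innerCore (N : ℕ) (s m T : ℝ) :
    PreInnerProductSpace.Core ℝ (TestFun N s m T) where
  inner v w := ∫ p in halfCylinder N T, energyDensity s m v.toFun w.toFun p
  conj_inner_symm v w := by
    simp only [conj_trivial]
    exact integral_congr_ae (ae_of_all _ fun p => energyDensity_comm s m _ _ p)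
  re_inner_nonneg v := by
    refine setIntegral_nonneg (isOpen_halfCylinder N T).measurableSet fun p hp => ?_
    exact energyDensity_self_nonneg s m _ hp.2
  add_left u v w := by
    rw [← integral_add (u.mem.1.integrableOn w.mem.1 u.mem.2 w.mem.2)
      (v.mem.1.integrableOn w.mem.1 v.mem.2 w.mem.2)]
    refine setIntegral_congr_fun (isOpen_halfCylinder N T).measurableSet fun p hp => ?_
    exact energyDensity_add s m _ (u.mem.1.differentiableAt hp.2) (v.mem.1.differentiableAt hp.2)
  smul_left v w c := by
    simp only [conj_trivial]
    rw [← integral_const_mul]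
    exact integral_congr_ae (ae_of_all _ fun p => energyDensity_smul s m c _ _ p)

noncomputable instance (N : ℕ) (s m T : ℝ) : SeminormedAddCommGroup (TestFun N s m T) :=
  letI := innerCore N s m T
  InnerProductSpace.Core.toSeminormedAddCommGroup (𝕜 := ℝ)

noncomputable instance (N : ℕ) (s m T : ℝ) : InnerProductSpace ℝ (TestFun N s m T) :=
  InnerProductSpace.ofCore (innerCore N s m T)

theorem norm_sq_testFun {N : ℕ} {s m T : ℝ} (v : TestFun N s m T) :
    ‖v‖ ^ 2 = ∫ p in halfCylinder N T, energyDensity s m v.toFun v.toFun p := by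
  rw [← real_inner_self_eq_norm_sq v]
  rfl

/-- The Hilbert space obtained by completing the smooth periodic functions in the norm
`(∫∫ y^(1-2s) (|∇v|² + m² v²))^(1/2)`. -/
abbrev X (N : ℕ) (s m T : ℝ) : Type := UniformSpace.Completion (TestFun N s m T)

/-- Lebesgue measure on `(0,T)^N`. -/
noncomputable def cellMeasure (N : ℕ) (T : ℝ) : Measure (EuclideanSpace ℝ (Fin N)) :=
  volume.restrict (cell N T)

theorem trace_bound_real {s : ℝ} (hs0 : 0 < s) (hs1 : s < 1) {g D : ℝ → ℝ}
    (hg : ContinuousOn g (Icc 0 1)) (hD : ContinuousOn D (Icc 0 1))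
    (hgD : ∀ y ∈ Ioo (0 : ℝ) 1, HasDerivAt g (D y) y) :
    g 0 ^ 2 ≤ (4 + 1 / s) * ∫ y in (0 : ℝ)..1, y ^ (1 - 2 * s) * (g y ^ 2 + D y ^ 2) := by
  have hw : ∀ {f : ℝ → ℝ}, ContinuousOn f (Icc 0 1) →
      IntervalIntegrable (fun y => y ^ (1 - 2 * s) * f y) volume 0 1 := fun hf =>
    (intervalIntegral.intervalIntegrable_rpow' (by linarith)).mul_continuousOn
      (by rwa [uIcc_of_le zero_le_one])
  have hsub : ∀ {y : ℝ}, y ∈ Ioo (0 : ℝ) 1 → uIcc 0 y ⊆ uIcc (0 : ℝ) 1 := fun {y} hy => by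
    rw [uIcc_of_le hy.1.le, uIcc_of_le zero_le_one]
    exact Icc_subset_Icc_right hy.2.le
  have hw0 : ∀ {y : ℝ}, y ∈ Ioo (0 : ℝ) 1 → 0 ≤ y ^ (1 - 2 * s) := fun hy =>
    Real.rpow_nonneg hy.1.le _
  set A := ∫ y in (0 : ℝ)..1, y ^ (1 - 2 * s) * g y ^ 2 with hA
  set P := ∫ y in (0 : ℝ)..1, y ^ (1 - 2 * s) * D y ^ 2 with hP
  have hnn : ∀ f : ℝ → ℝ, 0 ≤ ∫ y in (0 : ℝ)..1, y ^ (1 - 2 * s) * f y ^ 2 := fun f =>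
    intervalIntegral.integral_nonneg zero_le_one fun y hy =>
      mul_nonneg (Real.rpow_nonneg hy.1 _) (sq_nonneg _)
  have hA0 : 0 ≤ A := hnn g
  have hP0 : 0 ≤ P := hnn D
  have hsum : ∫ y in (0 : ℝ)..1, y ^ (1 - 2 * s) * (g y ^ 2 + D y ^ 2) = A + P := by
    simp only [mul_add]
    exact intervalIntegral.integral_add (hw (hg.pow 2)) (hw (hD.pow 2))
  have hpt : ∀ y ∈ Ioo (0 : ℝ) 1, g 0 ^ 2 ≤ 2 * g y ^ 2 + P / s := by
    intro y hy
    have hI : ∫ t in (0 : ℝ)..y, D t = g y - g 0 := by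
      refine intervalIntegral.integral_eq_sub_of_hasDerivAt_of_le hy.1.le
        (hg.mono (Icc_subset_Icc_right hy.2.le))
        (fun t ht => hgD t ⟨ht.1, ht.2.trans hy.2⟩) ?_
      refine (hD.mono ?_).intervalIntegrable
      rw [uIcc_of_le hy.1.le]
      exact Icc_subset_Icc_right hy.2.le
    have hDi : IntervalIntegrable D volume 0 y := by
      refine (hD.mono ?_).intervalIntegrable
      rw [uIcc_of_le hy.1.le]
      exact Icc_subset_Icc_right hy.2.le
    have hPi : IntervalIntegrable (fun t => t ^ (1 - 2 * s) * D t ^ 2) volume 0 y :=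
      (hw (hD.pow 2)).mono_set (hsub hy)
    have hQi : IntervalIntegrable (fun t : ℝ => t ^ (2 * s - 1)) volume 0 y :=
      intervalIntegral.intervalIntegrable_rpow' (by linarith)
    have hPy : ∫ t in (0 : ℝ)..y, t ^ (1 - 2 * s) * D t ^ 2 ≤ P := by
      refine intervalIntegral.integral_mono_interval le_rfl hy.1.le hy.2.le ?_ (hw (hD.pow 2))
      refine (ae_restrict_iff' measurableSet_Ioc).2 (ae_of_all _ fun t ht => ?_)
      exact mul_nonneg (Real.rpow_nonneg ht.1.le _) (sq_nonneg _)
    have hQy : ∫ t in (0 : ℝ)..y, t ^ (2 * s - 1) ≤ 1 / (2 * s) := by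
      rw [integral_rpow (Or.inl (by linarith)), sub_add_cancel,
        Real.zero_rpow (by linarith), sub_zero]
      exact div_le_div_of_nonneg_right (Real.rpow_le_one hy.1.le hy.2.le (by linarith))
        (by linarith)
    have hquad : ∀ l : ℝ, 0 ≤ P * (l * l) + (2 * (g y - g 0)) * l + 1 / (2 * s) := by
      intro l
      have h1 : 0 ≤ ∫ t in (0 : ℝ)..y,
          (l ^ 2 * (t ^ (1 - 2 * s) * D t ^ 2) + (2 * l) * D t + t ^ (2 * s - 1)) := by
        rw [intervalIntegral.integral_of_le hy.1.le]
        refine setIntegral_nonneg measurableSet_Ioc fun t ht => ?_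
        have ha : 0 < t ^ (1 - 2 * s) := Real.rpow_pos_of_pos ht.1 _
        have hab : t ^ (2 * s - 1) = (t ^ (1 - 2 * s))⁻¹ := by
          rw [← Real.rpow_neg ht.1.le]; congr 1; ring
        rw [hab]
        have : l ^ 2 * (t ^ (1 - 2 * s) * D t ^ 2) + (2 * l) * D t + (t ^ (1 - 2 * s))⁻¹ =
            t ^ (1 - 2 * s) * (l * D t + (t ^ (1 - 2 * s))⁻¹) ^ 2 := by
          field_simp
          ring
        rw [this]
        positivity
      rw [intervalIntegral.integral_add ((hPi.const_mul _).add (hDi.const_mul _)) hQi,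
        intervalIntegral.integral_add (hPi.const_mul _) (hDi.const_mul _),
        intervalIntegral.integral_const_mul, intervalIntegral.integral_const_mul, hI] at h1
      nlinarith [mul_le_mul_of_nonneg_left hPy (sq_nonneg l)]
    have hd := discrim_le_zero hquad
    unfold discrim at hd
    have h2 : (g y - g 0) ^ 2 ≤ P / (2 * s) := by
      have : P / (2 * s) = P * (1 / (2 * s)) := by ring
      rw [this]; nlinarith
    have h3 : P / s = 2 * (P / (2 * s)) := by field_simp
    rw [h3]
    nlinarith [sq_nonneg (g y + (g y - g 0))]
  have hc : 0 < 2 - 2 * s := by linarith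
  have hone : ∫ y in (0 : ℝ)..1, y ^ (1 - 2 * s) = 1 / (2 - 2 * s) := by
    rw [integral_rpow (Or.inl (by linarith)), Real.zero_rpow (by linarith), Real.one_rpow]
    congr 1 <;> ring
  have hw1 : IntervalIntegrable (fun y : ℝ => y ^ (1 - 2 * s)) volume 0 1 :=
    intervalIntegral.intervalIntegrable_rpow' (by linarith)
  have hw2 : IntervalIntegrable (fun y : ℝ => y ^ (1 - 2 * s) * g y ^ 2) volume 0 1 :=
    hw (hg.pow 2)
  have hint : g 0 ^ 2 * (1 / (2 - 2 * s)) ≤ 2 * A + P / s * (1 / (2 - 2 * s)) := by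
    rw [← hone, hA, ← intervalIntegral.integral_const_mul, ← intervalIntegral.integral_const_mul,
      ← intervalIntegral.integral_const_mul, ← intervalIntegral.integral_add
        (hw2.const_mul _) (hw1.const_mul _)]
    refine intervalIntegral.integral_mono_on_of_le_Ioo zero_le_one
      (hw1.const_mul _) ((hw2.const_mul _).add (hw1.const_mul _)) fun y hy => ?_
    nlinarith [mul_le_mul_of_nonneg_left (hpt y hy) (hw0 hy)]
  rw [hsum]
  have h5 : g 0 ^ 2 ≤ (2 - 2 * s) * (2 * A) + P / s := by
    have := mul_le_mul_of_nonneg_left hint hc.le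
    have e1 : (2 - 2 * s) * (g 0 ^ 2 * (1 / (2 - 2 * s))) = g 0 ^ 2 := by
      rw [mul_left_comm, mul_one_div_cancel hc.ne', mul_one]
    have e2 : (2 - 2 * s) * (2 * A + P / s * (1 / (2 - 2 * s))) =
      (2 - 2 * s) * (2 * A) + P / s := by
      rw [mul_add, mul_left_comm _ (P / s), mul_one_div_cancel hc.ne', mul_one]
    linarith
  have h6 : P / s = 1 / s * P := by ring
  have h7 : 0 ≤ 1 / s * A := by positivity
  nlinarith [mul_nonneg hs0.le hA0]

theorem TestFun.trace_bound_fiber {N : ℕ} {s m T : ℝ} (hs0 : 0 < s) (hs1 : s < 1) (hm : 0 < m)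
    (v : TestFun N s m T) (x : EuclideanSpace ℝ (Fin N)) :
    ENNReal.ofReal (v.toFun (x, 0) ^ 2) ≤ ENNReal.ofReal ((4 + 1 / s) * (1 + 1 / m ^ 2)) *
      ∫⁻ y in Ioi (0 : ℝ), ENNReal.ofReal (energyDensity s m v.toFun v.toFun (x, y)) := by
  have hconv : UniqueDiffOn ℝ {p : EuclideanSpace ℝ (Fin N) × ℝ | 0 ≤ p.2} := by
    have hint : ((0 : EuclideanSpace ℝ (Fin N)), (1 : ℝ)) ∈
        interior {p : EuclideanSpace ℝ (Fin N) × ℝ | 0 ≤ p.2} :=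
      mem_interior.2 ⟨{p | 0 < p.2}, fun p (hp : 0 < p.2) => hp.le, isOpen_upper N,
        show (0 : ℝ) < 1 from one_pos⟩
    exact uniqueDiffOn_convex (convex_halfSpace_ge (f := Prod.snd)
      ⟨fun _ _ => rfl, fun _ _ => rfl⟩ 0) ⟨_, hint⟩
  set D : ℝ → ℝ := fun y => fderivWithin ℝ v.toFun {p | 0 ≤ p.2} (x, y) (0, 1) with hDdef
  have hc : ContinuousOn (fun y : ℝ => (x, y)) (Icc 0 1) := by fun_prop
  have hmaps : MapsTo (fun y : ℝ => (x, y)) (Icc 0 1) {p | 0 ≤ p.2} := fun y hy => hy.1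
  have hg : ContinuousOn (fun y => v.toFun (x, y)) (Icc 0 1) :=
    v.mem.1.contDiffOn.continuousOn.comp hc hmaps
  have hD : ContinuousOn D (Icc 0 1) :=
    ((v.mem.1.contDiffOn.continuousOn_fderivWithin hconv (by simp)).comp hc hmaps).clm_apply
      continuousOn_const
  have hDdy : ∀ y : ℝ, 0 < y → D y = dy v.toFun (x, y) := fun y hy => by
    have hn : {p : EuclideanSpace ℝ (Fin N) × ℝ | 0 ≤ p.2} ∈ 𝓝 (x, y) :=
      mem_of_superset ((isOpen_upper N).mem_nhds (x := (x, y)) hy) fun p (hp : 0 < p.2) => hp.le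
    simp only [hDdef, dy, fderivWithin_of_mem_nhds hn]
  have hgD : ∀ y ∈ Ioo (0 : ℝ) 1, HasDerivAt (fun y => v.toFun (x, y)) (D y) y := fun y hy => by
    rw [hDdy y hy.1]
    exact (v.mem.1.differentiableAt (p := (x, y)) hy.1).hasFDerivAt.comp_hasDerivAt y
      ((hasDerivAt_const y x).prodMk (hasDerivAt_id y))
  have hmain := trace_bound_real hs0 hs1 hg hD hgD
  have hii : IntegrableOn (fun y => y ^ (1 - 2 * s) * (v.toFun (x, y) ^ 2 + D y ^ 2)) (Ioc 0 1) := by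
    rw [← intervalIntegrable_iff_integrableOn_Ioc_of_le zero_le_one]
    refine (intervalIntegral.intervalIntegrable_rpow' (by linarith)).mul_continuousOn ?_
    rw [uIcc_of_le zero_le_one]
    exact (hg.pow 2).add (hD.pow 2)
  have hK : 0 ≤ 4 + 1 / s := by positivity
  have hM : 0 ≤ 1 + 1 / m ^ 2 := by positivity
  refine (ENNReal.ofReal_le_ofReal hmain).trans ?_
  rw [ENNReal.ofReal_mul hK, ENNReal.ofReal_mul hK, mul_assoc]
  refine mul_le_mul_right ?_ _
  rw [intervalIntegral.integral_of_le zero_le_one, ofReal_integral_eq_lintegral_ofReal hii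
    ((ae_restrict_iff' measurableSet_Ioc).2 (ae_of_all _ fun y hy =>
      mul_nonneg (Real.rpow_nonneg hy.1.le _) (by positivity))),
    ← lintegral_const_mul' _ _ ENNReal.ofReal_ne_top]
  refine (setLIntegral_mono' measurableSet_Ioc fun y hy => ?_).trans
    (lintegral_mono_set fun y hy => hy.1)
  rw [← ENNReal.ofReal_mul hM]
  refine ENNReal.ofReal_le_ofReal ?_
  rw [hDdy y hy.1]
  unfold energyDensity
  simp only
  rw [mul_left_comm]
  refine mul_le_mul_of_nonneg_left ?_ (Real.rpow_nonneg hy.1.le _)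
  have hS : 0 ≤ ∑ i, dx i v.toFun (x, y) * dx i v.toFun (x, y) :=
    Finset.sum_nonneg fun i _ => mul_self_nonneg _
  have e : (1 + 1 / m ^ 2) * (∑ i, dx i v.toFun (x, y) * dx i v.toFun (x, y) +
      dy v.toFun (x, y) * dy v.toFun (x, y) + m ^ 2 * (v.toFun (x, y) * v.toFun (x, y))) =
      (v.toFun (x, y) ^ 2 + dy v.toFun (x, y) ^ 2) + ((1 + 1 / m ^ 2) *
        (∑ i, dx i v.toFun (x, y) * dx i v.toFun (x, y)) + 1 / m ^ 2 * dy v.toFun (x, y) ^ 2 +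
        m ^ 2 * v.toFun (x, y) ^ 2) := by
    field_simp
    ring
  rw [e]
  have : 0 ≤ (1 + 1 / m ^ 2) * (∑ i, dx i v.toFun (x, y) * dx i v.toFun (x, y)) +
      1 / m ^ 2 * dy v.toFun (x, y) ^ 2 + m ^ 2 * v.toFun (x, y) ^ 2 := by positivity
  linarith

theorem TestFun.continuous_boundary {N : ℕ} {s m T : ℝ} (v : TestFun N s m T) :
    Continuous fun x : EuclideanSpace ℝ (Fin N) => v.toFun (x, 0) :=
  v.mem.1.contDiffOn.continuousOn.comp_continuous (by fun_prop) fun x => le_refl (0 : ℝ)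

theorem TestFun.eLpNorm_boundary_le {N : ℕ} {s m T : ℝ} (hs0 : 0 < s) (hs1 : s < 1) (hm : 0 < m)
    (v : TestFun N s m T) :
    eLpNorm (fun x => v.toFun (x, 0)) 2 (cellMeasure N T) ≤
      ENNReal.ofReal (√((4 + 1 / s) * (1 + 1 / m ^ 2)) * ‖v‖) := by
  have hK : 0 ≤ (4 + 1 / s) * (1 + 1 / m ^ 2) := by positivity
  have h1 : ∫⁻ x in cell N T, ENNReal.ofReal (v.toFun (x, 0) ^ 2) ≤
      ENNReal.ofReal ((4 + 1 / s) * (1 + 1 / m ^ 2)) * ENNReal.ofReal (‖v‖ ^ 2) := by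
    refine (lintegral_mono fun x => TestFun.trace_bound_fiber hs0 hs1 hm v x).trans ?_
    rw [lintegral_const_mul' _ _ ENNReal.ofReal_ne_top]
    refine mul_le_mul_right ?_ _
    rw [norm_sq_testFun, ofReal_integral_eq_lintegral_ofReal v.mem.2
      ((ae_restrict_iff' (isOpen_halfCylinder N T).measurableSet).2 (ae_of_all _ fun p hp =>
        energyDensity_self_nonneg s m _ hp.2))]
    have hmeas := (v.mem.1.aestronglyMeasurable (s := s) (m := m) v.mem.1).aemeasurable.ennreal_ofReal
    have hvol : (volume : Measure (EuclideanSpace ℝ (Fin N) × ℝ)).restrict (halfCylinder N T) =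
        (volume.restrict (cell N T)).prod (volume.restrict (Ioi 0)) := by
      rw [Measure.prod_restrict]; rfl
    rw [hvol] at hmeas ⊢
    rw [lintegral_prod _ hmeas]
  rw [eLpNorm_eq_lintegral_rpow_enorm_toReal (by simp) (by simp)]
  simp only [ENNReal.toReal_ofNat]
  rw [one_div, ENNReal.rpow_inv_le_iff two_pos,
    ENNReal.ofReal_rpow_of_nonneg (by positivity) (by norm_num)]
  simp only [cellMeasure, ENNReal.rpow_two, Real.rpow_two, mul_pow, Real.sq_sqrt hK]
  rw [ENNReal.ofReal_mul hK]
  refine le_trans (le_of_eq (lintegral_congr fun x => ?_)) h1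
  rw [← enorm_pow, Real.enorm_eq_ofReal (sq_nonneg _)]

theorem TestFun.memLp_boundary {N : ℕ} {s m T : ℝ} (hs0 : 0 < s) (hs1 : s < 1) (hm : 0 < m)
    (v : TestFun N s m T) : MemLp (fun x => v.toFun (x, 0)) 2 (cellMeasure N T) :=
  ⟨v.continuous_boundary.aestronglyMeasurable,
    (v.eLpNorm_boundary_le hs0 hs1 hm).trans_lt ENNReal.ofReal_lt_top⟩

/-- The restriction `v ↦ v(·, 0)` on smooth functions. -/
noncomputable def restrictBoundary (N : ℕ) (s m T : ℝ) (hs0 : 0 < s) (hs1 : s < 1) (hm : 0 < m) :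
    TestFun N s m T →L[ℝ] Lp ℝ 2 (cellMeasure N T) :=
  LinearMap.mkContinuous
    { toFun := fun v => (v.memLp_boundary hs0 hs1 hm).toLp
      map_add' := fun _ _ => rfl
      map_smul' := fun _ _ => rfl }
    (√((4 + 1 / s) * (1 + 1 / m ^ 2)))
    (fun v => by
      change ‖(v.memLp_boundary hs0 hs1 hm).toLp‖ ≤ _
      rw [Lp.norm_toLp]
      exact ENNReal.toReal_le_of_le_ofReal (by positivity) (v.eLpNorm_boundary_le hs0 hs1 hm))

/-- The trace operator: the continuous extension of `v ↦ v(·, 0)` to the completion `X`. -/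
noncomputable def Tr (N : ℕ) (s m T : ℝ) (hs0 : 0 < s) (hs1 : s < 1) (hm : 0 < m) :
    X N s m T →L[ℝ] Lp ℝ 2 (cellMeasure N T) :=
  (restrictBoundary N s m T hs0 hs1 hm).fromCompletion

theorem Tr_coe (N : ℕ) (s m T : ℝ) (hs0 : 0 < s) (hs1 : s < 1) (hm : 0 < m)
    (v : TestFun N s m T) :
    Tr N s m T hs0 hs1 hm (v : X N s m T) =ᵐ[cellMeasure N T] fun x => v.toFun (x, 0) := by
  rw [Tr, ContinuousLinearMap.fromCompletion_apply_coe]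
  exact (v.memLp_boundary hs0 hs1 hm).coeFn_toLp

/-- The Fourier coefficients `c_k = T^(-N/2) ∫ u(x) exp(-i ω k·x) dx`, with `ω = 2π/T`. -/
noncomputable def fourierCoef {N : ℕ} {T : ℝ} (u : Lp ℝ 2 (cellMeasure N T)) (k : Fin N → ℤ) : ℂ :=
  ((1 / √(T ^ N) : ℝ) : ℂ) * ∫ x, (u x : ℂ) *
    Complex.exp (-(Complex.I * ((2 * Real.pi / T * ∑ i, (k i : ℝ) * x i : ℝ) : ℂ)))
    ∂(cellMeasure N T)

/-- The term `(ω² |k|² + m²)^s |c_k|²`, with `ω = 2π/T`. -/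
noncomputable def hTerm {N : ℕ} {T : ℝ} (s m : ℝ) (u : Lp ℝ 2 (cellMeasure N T))
    (k : Fin N → ℤ) : ℝ :=
  ((2 * Real.pi / T) ^ 2 * (∑ i, (k i : ℝ) ^ 2) + m ^ 2) ^ s * ‖fourierCoef u k‖ ^ 2

/-- The fractional Sobolev space of periodic functions: those `u ∈ L²((0,T)^N)` with
`∑ (ω² |k|² + m²)^s |c_k|² < ∞`. -/
def H (N : ℕ) (s m T : ℝ) : Set (Lp ℝ 2 (cellMeasure N T)) :=
  {u | Summable (hTerm s m u)}

/-- The norm `(∑ (ω² |k|² + m²)^s |c_k|²)^(1/2)` of `H`. -/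
noncomputable def hNorm {N : ℕ} {T : ℝ} (s m : ℝ) (u : Lp ℝ 2 (cellMeasure N T)) : ℝ :=
  √(∑' k, hTerm s m u k)

/-- The set `W ⊆ L²((0,T)^N)`, normed by `ν`, embeds continuously into `L^q((0,T)^N)`: it is
contained in `L^q`, with `|u|_{L^q} ≤ C ν(u)`. -/
def ContinuouslyEmbedded {N : ℕ} {T : ℝ} (W : Set (Lp ℝ 2 (cellMeasure N T)))
    (ν : Lp ℝ 2 (cellMeasure N T) → ℝ) (q : ℝ) : Prop :=
  ∃ C : ℝ, 0 < C ∧ ∀ u ∈ W, MemLp u (ENNReal.ofReal q) (cellMeasure N T) ∧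
    eLpNorm u (ENNReal.ofReal q) (cellMeasure N T) ≤ ENNReal.ofReal (C * ν u)

/-- The embedding is continuous, and every sequence of `W` that is bounded for `ν` has a
subsequence that converges in `L^q((0,T)^N)`. -/
def CompactlyEmbedded {N : ℕ} {T : ℝ} (W : Set (Lp ℝ 2 (cellMeasure N T)))
    (ν : Lp ℝ 2 (cellMeasure N T) → ℝ) (q : ℝ) : Prop :=
  ContinuouslyEmbedded W ν q ∧
  ∀ u : ℕ → Lp ℝ 2 (cellMeasure N T), (∀ j, u j ∈ W) → (∃ M : ℝ, ∀ j, ν (u j) ≤ M) →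
    ∃ w : EuclideanSpace ℝ (Fin N) → ℝ, MemLp w (ENNReal.ofReal q) (cellMeasure N T) ∧
      ∃ φ : ℕ → ℕ, StrictMono φ ∧
        Tendsto (fun j => eLpNorm (fun x => u (φ j) x - w x) (ENNReal.ofReal q)
          (cellMeasure N T)) atTop (𝓝 0)

end PeriodicExt

/-! Write λ_k² = ω²|k|² + m² (this is `symb`). Everything is read off the Fourier coefficients in x.

Trace inequality. Let c_k(y) be the coefficients of v(·,y). On each slice, Bessel's inequality
bounds the sum of λ_k²|c_k|² + |c_k'|² by the integral of |∇v|² + m²v². For each k, the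
one-dimensional weighted inequality `trace_bound_real`, rescaled to the length 1/λ_k
(`trace_bound_scaled`), bounds λ_k^{2s}|c_k(0)|² by (4 + 1/s) ∫ y^{1-2s}(λ_k²|c_k|² + |c_k'|²) dy.
Summing over k and using Tonelli gives the bound for smooth v; density gives it on the completion.

Surjectivity. The k-th wave of u ∈ H is extended by the factor exp(-λ_k y). By scaling, its energy
is at most a constant times λ_k^{2s}|c_k|². Waves of frequencies k and l are orthogonal unless l =
±k, so the sum of the extensions converges in X (`summable_of_inner_eq_zero`), and its trace has the
coefficients of u.

Critical Sobolev inequality, p = 2N/(N-2s). For each height t, u is split at a frequency threshold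
λ_k² ≤ R(t). The low part is at most t/2 in sup norm, by Cauchy–Schwarz and the lattice estimate
`exists_sum_symb_rpow_neg_le`. The set where |u| > t is then controlled by the high part through
Chebyshev and Parseval (`measure_lt_abs_le`). In the layer-cake formula the t-integral is computed
mode by mode and returns exactly the weight λ_k^{2s}. Smaller q follow because the cell has finite
measure.

Compactness. The modes with λ_k² > R contribute at most R^{-s}|u|_H² to the squared L² norm, so
convergence of each coefficient along a subsequence gives L² convergence. Interpolation with the L^p
bound upgrades it to L^q for q < p. -/

namespace PeriodicExt

-- Fourier series on the cell, transferred from the unit torus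

attribute [local instance] instMeasureSpaceUnitAddCircle

/-- The phase `ω k·x`, with `ω = 2π/T`. -/
noncomputable def phase {N : ℕ} (T : ℝ) (k : Fin N → ℤ) (x : EuclideanSpace ℝ (Fin N)) : ℝ :=
  2 * Real.pi / T * ∑ i, (k i : ℝ) * x i

/-- The exponential `exp(i ω k·x)`. -/
noncomputable def expMode {N : ℕ} (T : ℝ) (k : Fin N → ℤ) (x : EuclideanSpace ℝ (Fin N)) : ℂ :=
  Complex.exp (Complex.I * (phase T k x : ℂ))

/-- The Fourier coefficients of a complex function on the cell. -/
noncomputable def coef {N : ℕ} (T : ℝ) (f : EuclideanSpace ℝ (Fin N) → ℂ) (k : Fin N → ℤ) : ℂ :=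
  ((1 / √(T ^ N) : ℝ) : ℂ) * ∫ x, f x * expMode T (-k) x ∂(cellMeasure N T)

theorem phase_neg {N : ℕ} (T : ℝ) (k : Fin N → ℤ) (x : EuclideanSpace ℝ (Fin N)) :
    phase T (-k) x = -phase T k x := by
  simp [phase]

theorem phase_add {N : ℕ} (T : ℝ) (k l : Fin N → ℤ) (x : EuclideanSpace ℝ (Fin N)) :
    phase T (k + l) x = phase T k x + phase T l x := by
  simp [phase, add_mul, Finset.sum_add_distrib, mul_add]

theorem continuous_phase {N : ℕ} (T : ℝ) (k : Fin N → ℤ) : Continuous (phase T k) := by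
  unfold phase; fun_prop

theorem continuous_expMode {N : ℕ} (T : ℝ) (k : Fin N → ℤ) : Continuous (expMode T k) := by
  have := continuous_phase T k
  unfold expMode; fun_prop

theorem expMode_add {N : ℕ} (T : ℝ) (k l : Fin N → ℤ) (x : EuclideanSpace ℝ (Fin N)) :
    expMode T (k + l) x = expMode T k x * expMode T l x := by
  rw [expMode, phase_add, expMode, expMode, ← Complex.exp_add]; push_cast; ring_nf

theorem conj_expMode {N : ℕ} (T : ℝ) (k : Fin N → ℤ) (x : EuclideanSpace ℝ (Fin N)) :
    (starRingEnd ℂ) (expMode T k x) = expMode T (-k) x := by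
  rw [expMode, expMode, ← Complex.exp_conj, phase_neg]; simp

theorem norm_expMode {N : ℕ} (T : ℝ) (k : Fin N → ℤ) (x : EuclideanSpace ℝ (Fin N)) :
    ‖expMode T k x‖ = 1 := by
  rw [expMode, mul_comm, Complex.norm_exp_ofReal_mul_I]

theorem fourierCoef_eq_coef {N : ℕ} {T : ℝ} (u : Lp ℝ 2 (cellMeasure N T)) (k : Fin N → ℤ) :
    fourierCoef u k = coef T (fun x => (u x : ℂ)) k := by
  simp only [fourierCoef, coef, expMode, phase_neg]
  simp [phase]

/-- The cube is the image of the torus under this section of the covering map. -/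
noncomputable def torusToCell {N : ℕ} (T : ℝ) (z : UnitAddTorus (Fin N)) :
    EuclideanSpace ℝ (Fin N) :=
  T • WithLp.toLp 2 (fun i => (AddCircle.equivIoc 1 0 (z i) : ℝ))

theorem mFourier_eq_expMode {N : ℕ} {T : ℝ} (hT : 0 < T) (k : Fin N → ℤ)
    (z : UnitAddTorus (Fin N)) :
    UnitAddTorus.mFourier k z = expMode T k (torusToCell T z) := by
  simp only [UnitAddTorus.mFourier, ContinuousMap.coe_mk, expMode, phase, torusToCell]
  have h : ∀ i, fourier (k i) (z i) = Complex.exp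
      (Complex.I * ((2 * Real.pi / T * ((k i : ℝ) * (T * (AddCircle.equivIoc 1 0 (z i) : ℝ))) : ℝ) : ℂ)) := by
    intro i
    conv_lhs => rw [← AddCircle.coe_equivIoc (p := (1 : ℝ)) (a := 0) (y := z i), fourier_coe_apply]
    congr 1
    push_cast
    have : (T : ℂ) ≠ 0 := by exact_mod_cast hT.ne'
    field_simp
  simp_rw [h, ← Complex.exp_sum, ← Finset.mul_sum]
  congr 2
  push_cast
  simp [Finset.mul_sum]

/-- The torus is identified with a unit cube and then dilated by T. The dilation accounts for the
density T^{-N}, which makes the target a probability measure like the source. -/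
theorem measurePreserving_torusToCell (N : ℕ) {T : ℝ} (hT : 0 < T) :
    MeasurePreserving (torusToCell (N := N) T) volume
      (ENNReal.ofReal (T ^ N)⁻¹ • cellMeasure N T) := by
  have hQm : MeasurableSet {x : Fin N → ℝ | ∀ i, x i ∈ Ioc (0 : ℝ) (0 + 1)} :=
    MeasurableSet.univ_pi' fun i => measurableSet_Ioc
  have h1 := (measurePreserving_subtype_coe (μa := volume) hQm).comp
    (UnitAddTorus.measurePreserving_equivPiIoc (d := Fin N) (fun _ => 0))
  have h2 : MeasurePreserving (fun x : EuclideanSpace ℝ (Fin N) => T • x) volume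
      (ENNReal.ofReal (T ^ N)⁻¹ • volume) := by
    refine ⟨measurable_const_smul T, ?_⟩
    have := Measure.map_addHaar_smul (volume : Measure (EuclideanSpace ℝ (Fin N))) hT.ne'
    rw [this, finrank_euclideanSpace_fin, abs_of_nonneg (by positivity)]
  have h3 := (h2.comp (PiLp.volume_preserving_toLp (Fin N))).restrict_preimage
    (isOpen_cell N T).measurableSet
  have hset : ((fun x : EuclideanSpace ℝ (Fin N) => T • x) ∘ WithLp.toLp 2) ⁻¹' cell N T =
      univ.pi fun _ => Ioo (0 : ℝ) 1 := by
    ext x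
    simp only [cell, Function.comp, mem_preimage, mem_ofPred_eq, mem_univ_pi, PiLp.smul_apply,
      smul_eq_mul, mem_Ioo]
    refine forall_congr' fun i => ?_
    rw [mul_pos_iff_of_pos_left hT]
    refine and_congr_right fun _ => ?_
    constructor <;> intro h <;> nlinarith
  rw [hset, Measure.restrict_smul] at h3
  -- `equivIoc` takes values in the half-open cube, whereas the cell is open; the faces in between
  -- are null.
  have hae : (volume : Measure (Fin N → ℝ)).restrict {x | ∀ i, x i ∈ Ioc (0 : ℝ) (0 + 1)} =
      volume.restrict (univ.pi fun _ => Ioo (0 : ℝ) 1) := by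
    have e : {x : Fin N → ℝ | ∀ i, x i ∈ Ioc (0 : ℝ) (0 + 1)} = univ.pi fun _ => Ioc (0 : ℝ) 1 := by
      ext x; simp
    rw [e]
    refine Measure.restrict_congr_set ?_
    rw [volume_pi]
    exact Measure.univ_pi_Ioc_ae_eq_Icc.trans Measure.univ_pi_Ioo_ae_eq_Icc.symm
  rw [hae] at h1
  exact h3.comp h1

instance isFiniteMeasure_cellMeasure (N : ℕ) (T : ℝ) : IsFiniteMeasure (cellMeasure N T) := by
  have hsub : cell N T ⊆ WithLp.toLp 2 '' (univ.pi fun _ : Fin N => Icc (0 : ℝ) T) := fun x hx =>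
    ⟨WithLp.ofLp x, fun i _ => ⟨(hx i).1.le, (hx i).2.le⟩, rfl⟩
  have hc : IsCompact (WithLp.toLp 2 '' (univ.pi fun _ : Fin N => Icc (0 : ℝ) T)) :=
    (isCompact_univ_pi fun _ => isCompact_Icc).image (PiLp.continuous_toLp 2 _)
  exact ⟨by simpa [cellMeasure] using (measure_mono hsub).trans_lt hc.measure_lt_top⟩

theorem integral_torus {N : ℕ} {T : ℝ} (hT : 0 < T) {F : Type*} [NormedAddCommGroup F]
    [NormedSpace ℝ F] {f : EuclideanSpace ℝ (Fin N) → F}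
    (hf : AEStronglyMeasurable f (cellMeasure N T)) :
    ∫ z, f (torusToCell T z) = (T ^ N)⁻¹ • ∫ x, f x ∂(cellMeasure N T) := by
  have h := measurePreserving_torusToCell N hT
  rw [← integral_map h.measurable.aemeasurable (by rw [h.map_eq]; exact hf.smul_measure _),
    h.map_eq, integral_smul_measure, ENNReal.toReal_ofReal (by positivity)]

/-- The torus coefficient is an average, with prefactor T^{-N}, while `coef` carries T^{-N/2}; the
quotient is √(T^N). -/
theorem coef_eq_mFourierCoeff {N : ℕ} {T : ℝ} (hT : 0 < T) {f : EuclideanSpace ℝ (Fin N) → ℂ}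
    (hf : AEStronglyMeasurable f (cellMeasure N T)) (k : Fin N → ℤ) :
    coef T f k = (√(T ^ N) : ℂ) *
      UnitAddTorus.mFourierCoeff (fun z => f (torusToCell T z)) k := by
  have hm : AEStronglyMeasurable (fun x => f x * expMode T (-k) x) (cellMeasure N T) :=
    hf.mul (continuous_expMode T _).aestronglyMeasurable
  have h := integral_torus hT hm
  simp only [UnitAddTorus.mFourierCoeff, mFourier_eq_expMode hT, smul_eq_mul]
  simp_rw [mul_comm (expMode T (-k) _)]
  rw [h, coef, Complex.real_smul, ← mul_assoc]
  congr 1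
  have h0 : √(T ^ N) ≠ 0 := by positivity
  have h1 : (T ^ N)⁻¹ = (√(T ^ N) * √(T ^ N))⁻¹ := by rw [Real.mul_self_sqrt (by positivity)]
  rw [h1, ← Complex.ofReal_mul]
  congr 1
  field_simp

/-- **Parseval's identity** on the cell. -/
theorem hasSum_sq_coef {N : ℕ} {T : ℝ} (hT : 0 < T) {f : EuclideanSpace ℝ (Fin N) → ℂ}
    (hf : MemLp f 2 (cellMeasure N T)) :
    HasSum (fun k => ‖coef T f k‖ ^ 2) (∫ x, ‖f x‖ ^ 2 ∂(cellMeasure N T)) := by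
  have hp := measurePreserving_torusToCell N hT
  have hg : MemLp (f ∘ torusToCell T) 2 volume :=
    (hf.smul_measure ENNReal.ofReal_ne_top).comp_measurePreserving hp
  have h := UnitAddTorus.hasSum_sq_mFourierCoeff (hg.toLp _)
  have e1 : ∫ z, ‖hg.toLp _ z‖ ^ 2 = (T ^ N)⁻¹ * ∫ x, ‖f x‖ ^ 2 ∂(cellMeasure N T) := by
    rw [← smul_eq_mul, ← integral_torus hT (f := fun x => ‖f x‖ ^ 2) (hf.1.norm.pow 2)]
    exact integral_congr_ae (hg.coeFn_toLp.mono fun z hz => by simp [hz])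
  have e2 : ∀ k, ‖coef T f k‖ ^ 2 = T ^ N * ‖UnitAddTorus.mFourierCoeff (hg.toLp _) k‖ ^ 2 := by
    intro k
    rw [coef_eq_mFourierCoeff hT hf.1, norm_mul, mul_pow, Complex.norm_real, Real.norm_eq_abs,
      sq_abs, Real.sq_sqrt (by positivity)]
    congr 3
    exact integral_congr_ae (hg.coeFn_toLp.mono fun z hz => by simp [hz])
  rw [e1] at h
  simp_rw [e2]
  have := h.mul_left (T ^ N)
  rwa [← mul_assoc, mul_inv_cancel₀ (by positivity), one_mul] at this

theorem hasSum_sq_fourierCoef {N : ℕ} {T : ℝ} (hT : 0 < T) (u : Lp ℝ 2 (cellMeasure N T)) :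
    HasSum (fun k => ‖fourierCoef u k‖ ^ 2) (‖u‖ ^ 2) := by
  have h := hasSum_sq_coef hT ((Lp.memLp u).ofReal (K := ℂ))
  simp only [fourierCoef_eq_coef]
  convert! h using 1
  rw [← real_inner_self_eq_norm_sq, L2.inner_def]
  exact integral_congr_ae (ae_of_all _ fun x => by simp)

theorem integral_expMode {N : ℕ} {T : ℝ} (hT : 0 < T) (k : Fin N → ℤ) :
    ∫ x, expMode T k x ∂(cellMeasure N T) = if k = 0 then ((T ^ N : ℝ) : ℂ) else 0 := by
  have h := integral_torus (N := N) hT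
    (continuous_expMode T k).aestronglyMeasurable
  simp_rw [← mFourier_eq_expMode hT] at h
  -- The integral of a mode is its inner product with the constant mode 0.
  have h2 := orthonormal_iff_ite.1 (UnitAddTorus.orthonormal_mFourier (d := Fin N)) 0 k
  rw [ContinuousMap.inner_toLp] at h2
  simp only [UnitAddTorus.mFourier_zero, ContinuousMap.one_apply, map_one, mul_one] at h2
  rw [h2] at h
  have h3 : ((T ^ N : ℝ) : ℂ) ≠ 0 := by exact_mod_cast (by positivity : (T ^ N : ℝ) ≠ 0)
  rw [Complex.real_smul, Complex.ofReal_inv] at h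
  have h4 := congrArg (fun w => ((T ^ N : ℝ) : ℂ) * w) h
  simp only [mul_inv_cancel_left₀ h3] at h4
  rw [← h4]
  by_cases hk : k = 0
  · simp [hk]
  · simp [hk, Ne.symm hk]

theorem coef_expMode {N : ℕ} {T : ℝ} (hT : 0 < T) (k l : Fin N → ℤ) :
    coef T (expMode T l) k = if l = k then (√(T ^ N) : ℂ) else 0 := by
  have h : ∀ x : EuclideanSpace ℝ (Fin N), expMode T l x * expMode T (-k) x =
      expMode T (l - k) x := fun x => by rw [← expMode_add, sub_eq_add_neg]
  simp_rw [coef, h, integral_expMode hT, sub_eq_zero]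
  split_ifs
  · rw [← Complex.ofReal_mul]
    congr 1
    have h1 : T ^ N = √(T ^ N) * √(T ^ N) := by rw [Real.mul_self_sqrt (by positivity)]
    have h0 : √(T ^ N) ≠ 0 := by positivity
    field_simp
    nlinarith
  · simp

theorem integrable_mul_expMode {N : ℕ} {T : ℝ} {f : EuclideanSpace ℝ (Fin N) → ℂ}
    (hf : Integrable f (cellMeasure N T)) (k : Fin N → ℤ) :
    Integrable (fun x => f x * expMode T k x) (cellMeasure N T) :=
  hf.mul_bdd (c := 1) (continuous_expMode T k).aestronglyMeasurable
    (ae_of_all _ fun x => (norm_expMode T k x).le)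

theorem coef_add {N : ℕ} {T : ℝ} {f g : EuclideanSpace ℝ (Fin N) → ℂ}
    (hf : Integrable f (cellMeasure N T)) (hg : Integrable g (cellMeasure N T))
    (k : Fin N → ℤ) : coef T (fun x => f x + g x) k = coef T f k + coef T g k := by
  simp_rw [coef, add_mul]
  rw [integral_add (integrable_mul_expMode hf _) (integrable_mul_expMode hg _), mul_add]

theorem coef_sub {N : ℕ} {T : ℝ} {f g : EuclideanSpace ℝ (Fin N) → ℂ}
    (hf : Integrable f (cellMeasure N T)) (hg : Integrable g (cellMeasure N T))
    (k : Fin N → ℤ) : coef T (fun x => f x - g x) k = coef T f k - coef T g k := by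
  simp_rw [coef, sub_mul]
  rw [integral_sub (integrable_mul_expMode hf _) (integrable_mul_expMode hg _), mul_sub]

theorem coef_const_mul {N : ℕ} {T : ℝ} (c : ℂ) (f : EuclideanSpace ℝ (Fin N) → ℂ)
    (k : Fin N → ℤ) : coef T (fun x => c * f x) k = c * coef T f k := by
  simp_rw [coef, mul_assoc, integral_const_mul]
  ring

theorem coef_sum {N : ℕ} {T : ℝ} {ι : Type*} (F : Finset ι)
    {f : ι → EuclideanSpace ℝ (Fin N) → ℂ} (hf : ∀ j ∈ F, Integrable (f j) (cellMeasure N T))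
    (k : Fin N → ℤ) : coef T (fun x => ∑ j ∈ F, f j x) k = ∑ j ∈ F, coef T (f j) k := by
  simp_rw [coef, Finset.sum_mul]
  rw [integral_finsetSum _ fun j hj => integrable_mul_expMode (hf j hj) _, Finset.mul_sum]

theorem coef_congr_ae {N : ℕ} {T : ℝ} {f g : EuclideanSpace ℝ (Fin N) → ℂ}
    (h : f =ᵐ[cellMeasure N T] g) (k : Fin N → ℤ) : coef T f k = coef T g k := by
  unfold coef
  congr 1
  exact integral_congr_ae (h.mono fun x hx => by simp [hx])

/-- The reality condition: it lets the modes k and -k be recombined into real waves when a preimage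
under the trace is built. -/
theorem coef_neg_ofReal {N : ℕ} {T : ℝ} (f : EuclideanSpace ℝ (Fin N) → ℝ) (k : Fin N → ℤ) :
    coef T (fun x => (f x : ℂ)) (-k) = (starRingEnd ℂ) (coef T (fun x => (f x : ℂ)) k) := by
  simp only [coef, map_mul, Complex.conj_ofReal, ← integral_conj, conj_expMode]

theorem integrable_expMode {N : ℕ} (T : ℝ) (k : Fin N → ℤ) :
    Integrable (expMode T k) (cellMeasure N T) :=
  (memLp_top_of_bound (continuous_expMode T k).aestronglyMeasurable 1
    (ae_of_all _ fun x => (norm_expMode T k x).le)).integrable le_top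

theorem integrable_coe {N : ℕ} {T : ℝ} (u : Lp ℝ 2 (cellMeasure N T)) :
    Integrable (fun x => (u x : ℂ)) (cellMeasure N T) :=
  ((Lp.memLp u).integrable (by norm_num)).ofReal

theorem fourierCoef_add {N : ℕ} {T : ℝ} (u v : Lp ℝ 2 (cellMeasure N T)) (k : Fin N → ℤ) :
    fourierCoef (u + v) k = fourierCoef u k + fourierCoef v k := by
  simp only [fourierCoef_eq_coef]
  rw [← coef_add (integrable_coe u) (integrable_coe v)]
  exact coef_congr_ae ((Lp.coeFn_add u v).mono fun x hx => by
    simp only [hx, Pi.add_apply, Complex.ofReal_add]) k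

theorem fourierCoef_smul {N : ℕ} {T : ℝ} (c : ℝ) (u : Lp ℝ 2 (cellMeasure N T))
    (k : Fin N → ℤ) : fourierCoef (c • u) k = c * fourierCoef u k := by
  simp only [fourierCoef_eq_coef]
  rw [← coef_const_mul]
  exact coef_congr_ae ((Lp.coeFn_smul c u).mono fun x hx => by
    simp only [hx, Pi.smul_apply, smul_eq_mul, Complex.ofReal_mul]) k

/-- The `k`-th Fourier coefficient as a continuous linear functional. -/
noncomputable def fourierCoefCLM {N : ℕ} {T : ℝ} (hT : 0 < T) (k : Fin N → ℤ) :
    Lp ℝ 2 (cellMeasure N T) →L[ℝ] ℂ :=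
  LinearMap.mkContinuous
    { toFun := fun u => fourierCoef u k
      map_add' := fun u v => fourierCoef_add u v k
      map_smul' := fun c u => by simpa using fourierCoef_smul c u k } 1 fun u => by
    have h := hasSum_sq_fourierCoef hT u
    have h1 := h.summable.le_tsum k fun _ _ => sq_nonneg _
    rw [h.tsum_eq] at h1
    rw [one_mul]
    exact (pow_le_pow_iff_left₀ (norm_nonneg _) (norm_nonneg _) two_ne_zero).1 h1

@[simp]
theorem fourierCoefCLM_apply {N : ℕ} {T : ℝ} (hT : 0 < T) (k : Fin N → ℤ)
    (u : Lp ℝ 2 (cellMeasure N T)) : fourierCoefCLM hT k u = fourierCoef u k := rfl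

/-- Parseval applied to u - v. This is how the trace of the constructed extension is recognised as
the given function. -/
theorem fourierCoef_injective {N : ℕ} {T : ℝ} (hT : 0 < T) {u v : Lp ℝ 2 (cellMeasure N T)}
    (h : ∀ k, fourierCoef u k = fourierCoef v k) : u = v := by
  have h1 := hasSum_sq_fourierCoef hT (u - v)
  have h2 : ∀ k, fourierCoef (u - v) k = 0 := fun k => by
    rw [← fourierCoefCLM_apply hT, map_sub, fourierCoefCLM_apply, fourierCoefCLM_apply, h, sub_self]
  simp only [h2, norm_zero, ne_eq, OfNat.ofNat_ne_zero, not_false_eq_true, zero_pow] at h1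
  have h3 := h1.unique hasSum_zero
  exact sub_eq_zero.1 (norm_eq_zero.1 (pow_eq_zero_iff two_ne_zero |>.1 h3))

/-- The symbol `ω² |k|² + m²`, with `ω = 2π/T`. -/
noncomputable def symb {N : ℕ} (m T : ℝ) (k : Fin N → ℤ) : ℝ :=
  (2 * Real.pi / T) ^ 2 * (∑ i, (k i : ℝ) ^ 2) + m ^ 2

theorem hTerm_eq {N : ℕ} {T : ℝ} (s m : ℝ) (u : Lp ℝ 2 (cellMeasure N T)) (k : Fin N → ℤ) :
    hTerm s m u k = symb m T k ^ s * ‖fourierCoef u k‖ ^ 2 := rfl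

theorem sq_le_symb {N : ℕ} (m T : ℝ) (k : Fin N → ℤ) : m ^ 2 ≤ symb m T k := by
  have : 0 ≤ ∑ i, (k i : ℝ) ^ 2 := Finset.sum_nonneg fun i _ => sq_nonneg _
  unfold symb
  nlinarith [mul_nonneg (sq_nonneg (2 * Real.pi / T)) this]

theorem symb_pos {N : ℕ} {m : ℝ} (hm : 0 < m) (T : ℝ) (k : Fin N → ℤ) : 0 < symb m T k :=
  (pow_pos hm 2).trans_le (sq_le_symb m T k)

theorem symb_neg {N : ℕ} (m T : ℝ) (k : Fin N → ℤ) : symb m T (-k) = symb m T k := by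
  simp [symb]

theorem hTerm_nonneg {N : ℕ} {s m T : ℝ} (hm : 0 < m) (u : Lp ℝ 2 (cellMeasure N T))
    (k : Fin N → ℤ) : 0 ≤ hTerm s m u k :=
  mul_nonneg (Real.rpow_nonneg (symb_pos hm T k).le _) (sq_nonneg _)

/-! ### Periodic integration by parts -/

/-- Brings integrals over the cell to the form required by the divergence theorem, which concerns
closed boxes in `Fin N → ℝ`. -/
theorem integral_cell_eq_Icc {N : ℕ} {T : ℝ} {F : Type*} [NormedAddCommGroup F]
    [NormedSpace ℝ F] (f : EuclideanSpace ℝ (Fin N) → F) :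
    ∫ x, f x ∂(cellMeasure N T) =
      ∫ x in Icc (fun _ : Fin N => (0 : ℝ)) (fun _ => T), f (WithLp.toLp 2 x) := by
  have h := (PiLp.volume_preserving_toLp (Fin N)).restrict_preimage
    (isOpen_cell N T).measurableSet
  have e := h.integral_comp (MeasurableEquiv.toLp 2 (Fin N → ℝ)).measurableEmbedding f
  rw [cellMeasure, ← e]
  have hset : WithLp.toLp 2 ⁻¹' cell N T = univ.pi fun _ => Ioo (0 : ℝ) T := by
    ext x; simp [cell]
  rw [hset, Measure.restrict_congr_set]
  rw [volume_pi]
  exact Measure.univ_pi_Ioo_ae_eq_Icc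

/-- The integral of a partial derivative of a periodic function over the cell vanishes. -/
theorem integral_fderiv_single_eq_zero {N : ℕ} {T : ℝ} (hT : 0 < T)
    {h : EuclideanSpace ℝ (Fin N) → ℂ} (hh : ContDiff ℝ 1 h) (i : Fin N)
    (hper : ∀ x, h (x + EuclideanSpace.single i T) = h x) :
    ∫ x, fderiv ℝ h x (EuclideanSpace.single i 1) ∂(cellMeasure N T) = 0 := by
  classical
  cases N with
  | zero => exact i.elim0
  | succ n =>
    rw [integral_cell_eq_Icc]
    let e : (Fin (n + 1) → ℝ) →L[ℝ] EuclideanSpace ℝ (Fin (n + 1)) :=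
      (PiLp.continuousLinearEquiv 2 ℝ (fun _ : Fin (n + 1) => ℝ)).symm.toContinuousLinearMap
    have he : ∀ x, e x = WithLp.toLp 2 x := fun x => rfl
    have hd : ∀ x, HasFDerivAt (fun x => h (WithLp.toLp 2 x)) ((fderiv ℝ h (WithLp.toLp 2 x)).comp e) x :=
      fun x => ((hh.differentiable one_ne_zero) _).hasFDerivAt.comp x e.hasFDerivAt
    have hcont : Continuous fun x : Fin (n + 1) → ℝ => h (WithLp.toLp 2 x) :=
      hh.continuous.comp (PiLp.continuous_toLp 2 _)
    have hfc : Continuous fun x : Fin (n + 1) → ℝ =>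
        fderiv ℝ h (WithLp.toLp 2 x) (EuclideanSpace.single i 1) :=
      ((hh.continuous_fderiv one_ne_zero).comp (PiLp.continuous_toLp 2 _)).clm_apply
        continuous_const
    have hsum : ∀ x : Fin (n + 1) → ℝ, (∑ j, (if j = i then (fderiv ℝ h (WithLp.toLp 2 x)).comp e
        else 0 : (Fin (n + 1) → ℝ) →L[ℝ] ℂ) (Pi.single j 1)) =
        fderiv ℝ h (WithLp.toLp 2 x) (EuclideanSpace.single i 1) := by
      intro x
      rw [Finset.sum_eq_single i]
      · simp [he]
      · intro j _ hj; simp [hj]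
      · simp
    -- The divergence theorem for the vector field whose only nonzero component is h, in direction
    -- i; its divergence is the i-th partial derivative of h.
    have key := integral_divergence_of_hasFDerivAt_off_countable' (fun _ : Fin (n + 1) => (0 : ℝ))
      (fun _ => T) (fun _ => hT.le)
      (fun j => if j = i then fun x => h (WithLp.toLp 2 x) else 0)
      (fun j x => if j = i then (fderiv ℝ h (WithLp.toLp 2 x)).comp e else 0) ∅ countable_empty
      (fun j => by
        split_ifs
        · exact hcont.continuousOn
        · exact continuousOn_const)
      (fun x _ j => by
        split_ifs
        · exact hd x
        · exact hasFDerivAt_const 0 x)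
      (by
        simp_rw [hsum]
        exact hfc.continuousOn.integrableOn_compact isCompact_Icc)
    simp_rw [hsum] at key
    rw [key, Finset.sum_eq_single i]
    · simp only [if_true]
      -- What remains is the integral of h over the face x_i = T minus that over x_i = 0; the
      -- integrands agree by periodicity.
      rw [sub_eq_zero]
      congr 1
      ext x
      change h (WithLp.toLp 2 (i.insertNth T x)) = h (WithLp.toLp 2 (i.insertNth 0 x))
      rw [← hper (WithLp.toLp 2 (i.insertNth 0 x))]
      congr 1
      ext j
      rcases eq_or_ne j i with rfl | hj
      · simp
      · obtain ⟨l, rfl⟩ := Fin.exists_succAbove_eq hj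
        simp
    · intro j _ hj; simp [hj]
    · simp

theorem hasFDerivAt_phase {N : ℕ} (T : ℝ) (k : Fin N → ℤ) (x : EuclideanSpace ℝ (Fin N)) :
    HasFDerivAt (phase T k) ((2 * Real.pi / T) •
      ∑ i, (k i : ℝ) • (EuclideanSpace.proj i : EuclideanSpace ℝ (Fin N) →L[ℝ] ℝ)) x := by
  have h : phase T k = ((2 * Real.pi / T) •
      ∑ i, (k i : ℝ) • (EuclideanSpace.proj i : EuclideanSpace ℝ (Fin N) →L[ℝ] ℝ) :
        EuclideanSpace ℝ (Fin N) →L[ℝ] ℝ) := by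
    ext y; simp [phase]
  rw [h]
  exact ContinuousLinearMap.hasFDerivAt _

theorem phaseCLM_single {N : ℕ} (T : ℝ) (k : Fin N → ℤ) (i : Fin N) (t : ℝ) :
    ((2 * Real.pi / T) •
      ∑ i, (k i : ℝ) • (EuclideanSpace.proj i : EuclideanSpace ℝ (Fin N) →L[ℝ] ℝ) :
        EuclideanSpace ℝ (Fin N) →L[ℝ] ℝ) (EuclideanSpace.single i t) =
      2 * Real.pi / T * k i * t := by
  simp
  ring

theorem contDiff_phase {N : ℕ} (T : ℝ) (k : Fin N → ℤ) {n : WithTop ℕ∞} :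
    ContDiff ℝ n (phase T k) := by
  unfold phase; fun_prop

theorem contDiff_expMode {N : ℕ} (T : ℝ) (k : Fin N → ℤ) {n : WithTop ℕ∞} :
    ContDiff ℝ n (expMode T k) :=
  (contDiff_const.mul (Complex.ofRealCLM.contDiff.comp (contDiff_phase T k))).cexp

theorem fderiv_expMode_single {N : ℕ} (T : ℝ) (k : Fin N → ℤ) (x : EuclideanSpace ℝ (Fin N))
    (i : Fin N) : fderiv ℝ (expMode T k) x (EuclideanSpace.single i 1) =
      Complex.I * ((2 * Real.pi / T * k i : ℝ) : ℂ) * expMode T k x := by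
  have h := ((Complex.ofRealCLM.hasFDerivAt.comp x (hasFDerivAt_phase T k x)).const_mul
    Complex.I).cexp
  have h2 : HasFDerivAt (expMode T k) _ x := h
  rw [h2.fderiv, smul_apply, smul_apply,
    ContinuousLinearMap.comp_apply, phaseCLM_single]
  simp [expMode]
  ring

theorem phase_add_single {N : ℕ} {T : ℝ} (hT : 0 < T) (k : Fin N → ℤ) (i : Fin N)
    (x : EuclideanSpace ℝ (Fin N)) :
    phase T k (x + EuclideanSpace.single i T) = phase T k x + k i * (2 * Real.pi) := by
  simp only [phase, PiLp.add_apply, mul_add, Finset.sum_add_distrib]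
  congr 1
  simp
  field_simp

theorem expMode_add_single {N : ℕ} {T : ℝ} (hT : 0 < T) (k : Fin N → ℤ) (i : Fin N)
    (x : EuclideanSpace ℝ (Fin N)) :
    expMode T k (x + EuclideanSpace.single i T) = expMode T k x := by
  rw [expMode, expMode, phase_add_single hT,
    ← Complex.exp_periodic.int_mul (k i) (Complex.I * (phase T k x : ℂ))]
  congr 1; push_cast; ring

/-- The closed cube `[0,T]^N`. -/
def closedCell (N : ℕ) (T : ℝ) : Set (EuclideanSpace ℝ (Fin N)) :=
  WithLp.toLp 2 '' (univ.pi fun _ : Fin N => Icc (0 : ℝ) T)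

theorem isCompact_closedCell (N : ℕ) (T : ℝ) : IsCompact (closedCell N T) :=
  (isCompact_univ_pi fun _ => isCompact_Icc).image (PiLp.continuous_toLp 2 _)

theorem cell_subset_closedCell (N : ℕ) (T : ℝ) : cell N T ⊆ closedCell N T := fun x hx =>
  ⟨WithLp.ofLp x, fun i _ => ⟨(hx i).1.le, (hx i).2.le⟩, rfl⟩

theorem ae_cellMeasure_of_forall {N : ℕ} {T : ℝ} {P : EuclideanSpace ℝ (Fin N) → Prop}
    (h : ∀ x ∈ closedCell N T, P x) : ∀ᵐ x ∂(cellMeasure N T), P x :=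
  (ae_restrict_iff' (isOpen_cell N T).measurableSet).2
    (ae_of_all _ fun x hx => h x (cell_subset_closedCell N T hx))

theorem memLp_of_continuous {N : ℕ} {T : ℝ} {F : Type*} [NormedAddCommGroup F]
    {f : EuclideanSpace ℝ (Fin N) → F} (hf : Continuous f) (p : ℝ≥0∞) :
    MemLp f p (cellMeasure N T) := by
  obtain ⟨C, hC⟩ := (isCompact_closedCell N T).exists_bound_of_continuousOn hf.continuousOn
  exact MemLp.of_bound hf.aestronglyMeasurable C (ae_cellMeasure_of_forall hC)

theorem integrable_of_continuous {N : ℕ} {T : ℝ} {F : Type*} [NormedAddCommGroup F]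
    {f : EuclideanSpace ℝ (Fin N) → F} (hf : Continuous f) : Integrable f (cellMeasure N T) :=
  (memLp_of_continuous hf 2).integrable (by norm_num)

/-- Differentiation multiplies Fourier coefficients by `i ω k_i`. -/
theorem coef_fderiv_single {N : ℕ} {T : ℝ} (hT : 0 < T)
    {f : EuclideanSpace ℝ (Fin N) → ℝ} (hf : ContDiff ℝ 1 f) (i : Fin N)
    (hper : ∀ x, f (x + EuclideanSpace.single i T) = f x) (k : Fin N → ℤ) :
    coef T (fun x => (fderiv ℝ f x (EuclideanSpace.single i 1) : ℂ)) k =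
      Complex.I * ((2 * Real.pi / T * k i : ℝ) : ℂ) * coef T (fun x => (f x : ℂ)) k := by
  have hfc : ContDiff ℝ 1 fun x => (f x : ℂ) := Complex.ofRealCLM.contDiff.comp hf
  -- The product f·exp(-iω k·x) is periodic, so its derivative has integral zero; the product rule
  -- then moves the derivative onto the exponential.
  have h := integral_fderiv_single_eq_zero hT (hfc.mul (contDiff_expMode T (-k))) i
    (fun x => by rw [hper, expMode_add_single hT])
  have hd : ∀ x, fderiv ℝ (fun x => (f x : ℂ) * expMode T (-k) x) x (EuclideanSpace.single i 1) =
      (fderiv ℝ f x (EuclideanSpace.single i 1) : ℂ) * expMode T (-k) x -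
        Complex.I * ((2 * Real.pi / T * k i : ℝ) : ℂ) * ((f x : ℂ) * expMode T (-k) x) := by
    intro x
    have h1 := (hf.differentiable one_ne_zero x).hasFDerivAt
    have h2 : HasFDerivAt (fun x => (f x : ℂ)) (Complex.ofRealCLM.comp (fderiv ℝ f x)) x :=
      Complex.ofRealCLM.hasFDerivAt.comp x h1
    have h3 := ((contDiff_expMode T (-k) (n := 1)).differentiable one_ne_zero x).hasFDerivAt
    have h4 : fderiv ℝ (fun x => (f x : ℂ) * expMode T (-k) x) x = _ := (h2.mul h3).fderiv
    rw [h4]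
    simp only [add_apply, smul_apply, ContinuousLinearMap.comp_apply, smul_eq_mul,
      fderiv_expMode_single, Complex.ofRealCLM_apply]
    simp
    ring
  simp_rw [hd] at h
  have hc1 : Continuous fun x => (fderiv ℝ f x (EuclideanSpace.single i 1) : ℂ) :=
    Complex.continuous_ofReal.comp ((hf.continuous_fderiv one_ne_zero).clm_apply continuous_const)
  rw [integral_sub (integrable_mul_expMode (integrable_of_continuous hc1) _)
    ((integrable_mul_expMode (integrable_of_continuous hfc.continuous) _).const_mul _),
    integral_const_mul, sub_eq_zero] at h
  rw [coef, h, coef]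
  ring

/-! ### The trace inequality for smooth functions -/

/-- **Bessel's inequality** for continuous real functions. -/
theorem sum_sq_coef_le {N : ℕ} {T : ℝ} (hT : 0 < T) {f : EuclideanSpace ℝ (Fin N) → ℝ}
    (hf : Continuous f) (F : Finset (Fin N → ℤ)) :
    ∑ k ∈ F, ‖coef T (fun x => (f x : ℂ)) k‖ ^ 2 ≤ ∫ x, f x * f x ∂(cellMeasure N T) := by
  have h := hasSum_sq_coef hT (f := fun x => (f x : ℂ))
    (memLp_of_continuous (Complex.continuous_ofReal.comp hf) 2)
  refine (sum_le_hasSum F (fun _ _ => sq_nonneg _) h).trans (le_of_eq ?_)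
  exact integral_congr_ae (ae_of_all _ fun x => by simp [sq])

/-- A scaled version of `trace_bound_real` for complex functions. -/
theorem trace_bound_scaled {s : ℝ} (hs0 : 0 < s) (hs1 : s < 1) {l : ℝ} (hl : 0 < l) {g D : ℝ → ℂ}
    (hg : ContinuousOn g (Icc 0 (1 / l))) (hD : ContinuousOn D (Icc 0 (1 / l)))
    (hgD : ∀ y ∈ Ioo (0 : ℝ) (1 / l), HasDerivAt g (D y) y) :
    ENNReal.ofReal ((l ^ 2) ^ s * ‖g 0‖ ^ 2) ≤ ENNReal.ofReal (4 + 1 / s) *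
      ∫⁻ y in Ioi (0 : ℝ), ENNReal.ofReal (y ^ (1 - 2 * s) * (l ^ 2 * ‖g y‖ ^ 2 + ‖D y‖ ^ 2)) := by
  have hc : ContinuousOn (fun t : ℝ => t / l) (Icc 0 1) := by fun_prop
  have hmaps : MapsTo (fun t : ℝ => t / l) (Icc 0 1) (Icc 0 (1 / l)) := fun t ht =>
    ⟨div_nonneg ht.1 hl.le, div_le_div_of_nonneg_right ht.2 hl.le⟩
  have hg' := hg.comp hc hmaps
  have hD' := hD.comp hc hmaps
  have hder : ∀ t ∈ Ioo (0 : ℝ) 1, HasDerivAt (fun t => g (t / l)) (D (t / l) * ((1 / l : ℝ) : ℂ)) t := by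
    intro t ht
    have h1 := hgD (t / l) ⟨div_pos ht.1 hl, div_lt_div_of_pos_right ht.2 hl⟩
    have h2 : HasDerivAt (fun t : ℝ => t / l) (1 / l) t := (hasDerivAt_id t).div_const l
    have h3 := h1.scomp t h2
    convert! h3 using 1
    rw [Complex.real_smul, mul_comm]
  -- The rescaled function t ↦ g(t/l) lives on the unit interval. The real inequality is applied to
  -- its real and imaginary parts, and the two results are added.
  have hre := trace_bound_real hs0 hs1 (g := fun t => (g (t / l)).re)
    (D := fun t => (D (t / l)).re / l) (Complex.continuous_re.comp_continuousOn hg')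
    ((Complex.continuous_re.comp_continuousOn hD').div_const l)
    (fun t ht => by
      have := Complex.reCLM.hasFDerivAt.comp_hasDerivAt t (hder t ht)
      convert! this using 1
      rw [Complex.reCLM_apply, Complex.re_mul_ofReal, div_eq_mul_one_div])
  have him := trace_bound_real hs0 hs1 (g := fun t => (g (t / l)).im)
    (D := fun t => (D (t / l)).im / l) (Complex.continuous_im.comp_continuousOn hg')
    ((Complex.continuous_im.comp_continuousOn hD').div_const l)
    (fun t ht => by
      have := Complex.imCLM.hasFDerivAt.comp_hasDerivAt t (hder t ht)
      convert! this using 1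
      rw [Complex.imCLM_apply, Complex.im_mul_ofReal, div_eq_mul_one_div])
  have hii : ∀ {f : ℝ → ℝ}, ContinuousOn f (Icc 0 1) →
      IntervalIntegrable (fun y => y ^ (1 - 2 * s) * f y) volume 0 1 := fun hf =>
    (intervalIntegral.intervalIntegrable_rpow' (by linarith)).mul_continuousOn
      (by rwa [uIcc_of_le zero_le_one])
  have hsum := add_le_add hre him
  rw [← mul_add, ← intervalIntegral.integral_add
    (hii (f := fun t => (g (t / l)).re ^ 2 + ((D (t / l)).re / l) ^ 2)
      (((Complex.continuous_re.comp_continuousOn hg').pow 2).add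
      (((Complex.continuous_re.comp_continuousOn hD').div_const l).pow 2)))
    (hii (f := fun t => (g (t / l)).im ^ 2 + ((D (t / l)).im / l) ^ 2)
      (((Complex.continuous_im.comp_continuousOn hg').pow 2).add
      (((Complex.continuous_im.comp_continuousOn hD').div_const l).pow 2)))] at hsum
  have hnorm : ∀ z : ℂ, ‖z‖ ^ 2 = z.re ^ 2 + z.im ^ 2 := fun z => by
    rw [Complex.sq_norm, Complex.normSq_apply]; ring
  -- Homogeneity count: 1 + (1 - 2s) + 2s = 2.
  have hpow : l * l ^ (1 - 2 * s) * (l ^ 2) ^ s = l ^ 2 := by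
    rw [← Real.rpow_natCast l 2, ← Real.rpow_mul hl.le, mul_comm l, ← Real.rpow_add_one hl.ne',
      ← Real.rpow_add hl]
    congr 1; push_cast; ring
  set J := ∫ y in (0 : ℝ)..(1 / l), y ^ (1 - 2 * s) * (l ^ 2 * ‖g y‖ ^ 2 + ‖D y‖ ^ 2) with hJ
  -- Substituting t = l y: dt and the weight give l^{2-2s}, and extracting l^{-2} from the bracket
  -- leaves the factor l^{-2s}.
  have hscale : ∫ t in (0 : ℝ)..1, t ^ (1 - 2 * s) * ((g (t / l)).re ^ 2 + ((D (t / l)).re / l) ^ 2) +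
      t ^ (1 - 2 * s) * ((g (t / l)).im ^ 2 + ((D (t / l)).im / l) ^ 2) = (l ^ 2) ^ (-s) * J := by
    have h1 := intervalIntegral.integral_comp_div (a := 0) (b := 1) (fun y : ℝ =>
      (l ^ 2) ^ (-s) * l⁻¹ * (y ^ (1 - 2 * s) * (l ^ 2 * ‖g y‖ ^ 2 + ‖D y‖ ^ 2))) hl.ne'
    simp only [zero_div, intervalIntegral.integral_const_mul, smul_eq_mul] at h1
    rw [← hJ] at h1
    have h2 : l * ((l ^ 2) ^ (-s) * l⁻¹ * J) = (l ^ 2) ^ (-s) * J := by field_simp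
    rw [← h2, ← h1, ← intervalIntegral.integral_const_mul]
    refine intervalIntegral.integral_congr fun t ht => ?_
    rw [uIcc_of_le zero_le_one] at ht
    simp only [hnorm]
    rw [Real.div_rpow ht.1 hl.le]
    have hne : l ^ (1 - 2 * s) ≠ 0 := (Real.rpow_pos_of_pos hl _).ne'
    have h3 : (l ^ 2) ^ (-s) = l * l ^ (1 - 2 * s) / l ^ 2 := by
      rw [Real.rpow_neg (sq_nonneg l), inv_eq_iff_eq_inv, inv_div]
      have hne2 : (l ^ 2) ^ s ≠ 0 := (Real.rpow_pos_of_pos (pow_pos hl 2) _).ne'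
      rw [eq_div_iff (mul_ne_zero hl.ne' hne), mul_comm]
      exact hpow
    rw [h3]
    field_simp
    ring
  rw [hscale, ← hnorm, zero_div] at hsum
  have hposl : 0 < (l ^ 2) ^ s := Real.rpow_pos_of_pos (pow_pos hl 2) _
  have hmain : (l ^ 2) ^ s * ‖g 0‖ ^ 2 ≤ (4 + 1 / s) * J := by
    have := mul_le_mul_of_nonneg_left hsum hposl.le
    rw [Real.rpow_neg (sq_nonneg l)] at this
    refine this.trans (le_of_eq ?_)
    field_simp
  have hl1 : 0 ≤ 1 / l := by positivity
  refine (ENNReal.ofReal_le_ofReal hmain).trans ?_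
  rw [ENNReal.ofReal_mul (by positivity)]
  refine mul_le_mul_right ?_ _
  have hint : IntervalIntegrable (fun y : ℝ =>
      y ^ (1 - 2 * s) * (l ^ 2 * ‖g y‖ ^ 2 + ‖D y‖ ^ 2)) volume 0 (1 / l) := by
    refine (intervalIntegral.intervalIntegrable_rpow' (by linarith)).mul_continuousOn ?_
    rw [uIcc_of_le hl1]
    exact (continuousOn_const.mul (hg.norm.pow 2)).add (hD.norm.pow 2)
  rw [hJ, intervalIntegral.integral_of_le hl1, ofReal_integral_eq_lintegral_ofReal
    ((intervalIntegrable_iff_integrableOn_Ioc_of_le hl1).1 hint)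
    ((ae_restrict_iff' measurableSet_Ioc).2 (ae_of_all _ fun y hy =>
      mul_nonneg (Real.rpow_nonneg hy.1.le _) (by positivity)))]
  exact lintegral_mono_set fun y hy => hy.1

theorem uniqueDiffOn_closedUpper (N : ℕ) :
    UniqueDiffOn ℝ {p : EuclideanSpace ℝ (Fin N) × ℝ | 0 ≤ p.2} := by
  have hint : ((0 : EuclideanSpace ℝ (Fin N)), (1 : ℝ)) ∈
      interior {p : EuclideanSpace ℝ (Fin N) × ℝ | 0 ≤ p.2} :=
    mem_interior.2 ⟨{p | 0 < p.2}, fun p (hp : 0 < p.2) => hp.le, isOpen_upper N,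
      show (0 : ℝ) < 1 from one_pos⟩
  exact uniqueDiffOn_convex (convex_halfSpace_ge (f := Prod.snd)
    ⟨fun _ _ => rfl, fun _ _ => rfl⟩ 0) ⟨_, hint⟩

/-- The `y`-derivative up to the boundary. -/
noncomputable def dyWithin {N : ℕ} (v : EuclideanSpace ℝ (Fin N) × ℝ → ℝ)
    (p : EuclideanSpace ℝ (Fin N) × ℝ) : ℝ :=
  fderivWithin ℝ v {p | 0 ≤ p.2} p (0, 1)

theorem dyWithin_eq_dy {N : ℕ} (v : EuclideanSpace ℝ (Fin N) × ℝ → ℝ)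
    {p : EuclideanSpace ℝ (Fin N) × ℝ} (hp : 0 < p.2) : dyWithin v p = dy v p := by
  have hn : {p : EuclideanSpace ℝ (Fin N) × ℝ | 0 ≤ p.2} ∈ 𝓝 p :=
    mem_of_superset ((isOpen_upper N).mem_nhds hp) fun p (hp : 0 < p.2) => hp.le
  rw [dyWithin, dy, fderivWithin_of_mem_nhds hn]

/-- The one-dimensional inequality needs a derivative continuous up to y = 0. `dy` need not be,
since the values of v for y < 0 are arbitrary; the derivative within the closed half-space is. -/
theorem SmoothPeriodic.continuousOn_dyWithin {N : ℕ} {T : ℝ}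
    {v : EuclideanSpace ℝ (Fin N) × ℝ → ℝ} (hv : SmoothPeriodic T v) :
    ContinuousOn (dyWithin v) {p | 0 ≤ p.2} :=
  (hv.contDiffOn.continuousOn_fderivWithin (uniqueDiffOn_closedUpper N) (by simp)).clm_apply
    continuousOn_const

theorem continuous_slice {N : ℕ} {G : EuclideanSpace ℝ (Fin N) × ℝ → ℝ}
    (hG : ContinuousOn G {p | 0 ≤ p.2}) {y : ℝ} (hy : 0 ≤ y) : Continuous fun x => G (x, y) :=
  hG.comp_continuous (by fun_prop) fun _ => hy

theorem exists_bound_slice {N : ℕ} (T : ℝ) {G : EuclideanSpace ℝ (Fin N) × ℝ → ℝ}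
    (hG : ContinuousOn G {p | 0 ≤ p.2}) (R : ℝ) :
    ∃ C, ∀ x ∈ closedCell N T, ∀ y ∈ Icc 0 R, ‖G (x, y)‖ ≤ C := by
  obtain ⟨C, hC⟩ := ((isCompact_closedCell N T).prod (isCompact_Icc (a := (0 : ℝ)) (b := R))
    ).exists_bound_of_continuousOn (hG.mono fun p hp => hp.2.1)
  exact ⟨C, fun x hx y hy => hC (x, y) ⟨hx, hy⟩⟩

theorem continuousOn_coef_slice {N : ℕ} (T : ℝ) {G : EuclideanSpace ℝ (Fin N) × ℝ → ℝ}
    (hG : ContinuousOn G {p | 0 ≤ p.2}) (k : Fin N → ℤ) (R : ℝ) :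
    ContinuousOn (fun y => coef T (fun x => (G (x, y) : ℂ)) k) (Icc 0 R) := by
  obtain ⟨C, hC⟩ := exists_bound_slice T hG R
  refine continuousOn_const.mul (continuousOn_of_dominated (bound := fun _ => C) ?_ ?_
    (integrable_const C) (ae_of_all _ fun x => ?_))
  · intro y hy
    exact ((Complex.continuous_ofReal.comp (continuous_slice hG hy.1)).mul
      (continuous_expMode T _)).aestronglyMeasurable
  · intro y hy
    refine ae_cellMeasure_of_forall fun x hx => ?_
    rw [norm_mul, norm_expMode, mul_one, Complex.norm_real]
    exact hC x hx y hy
  · refine ContinuousOn.mul ?_ continuousOn_const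
    exact Complex.continuous_ofReal.comp_continuousOn
      (hG.comp (by fun_prop) fun y (hy : y ∈ Icc 0 R) => hy.1)

/-- Differentiation under the integral sign; the y-derivative is bounded on the compact set [0,T]^N
× [0, y+1], which supplies the dominating constant. -/
theorem SmoothPeriodic.hasDerivAt_coef_slice {N : ℕ} {T : ℝ}
    {v : EuclideanSpace ℝ (Fin N) × ℝ → ℝ} (hv : SmoothPeriodic T v) (k : Fin N → ℤ) {y : ℝ}
    (hy : 0 < y) : HasDerivAt (fun y => coef T (fun x => (v (x, y) : ℂ)) k)
      (coef T (fun x => (dyWithin v (x, y) : ℂ)) k) y := by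
  obtain ⟨C, hC⟩ := exists_bound_slice T hv.continuousOn_dyWithin (y + 1)
  have hmeas : ∀ {G : EuclideanSpace ℝ (Fin N) × ℝ → ℝ}, ContinuousOn G {p | 0 ≤ p.2} →
      ∀ t, 0 < t → Continuous (fun x => (G (x, t) : ℂ) * expMode T (-k) x) := fun hG t ht =>
    (Complex.continuous_ofReal.comp (continuous_slice hG ht.le)).mul (continuous_expMode T _)
  have hvc := hv.contDiffOn.continuousOn
  refine (hasDerivAt_integral_of_dominated_loc_of_deriv_le (bound := fun _ => C)
    (s := Ioo 0 (y + 1)) (Ioo_mem_nhds hy (by linarith)) ?_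
    (integrable_of_continuous (hmeas hvc y hy))
    (F' := fun t x => (dyWithin v (x, t) : ℂ) * expMode T (-k) x)
    (hmeas hv.continuousOn_dyWithin y hy).aestronglyMeasurable ?_ (integrable_const C) ?_).2.const_mul _
  · filter_upwards [Ioi_mem_nhds hy] with t ht
    exact (hmeas hvc t ht).aestronglyMeasurable
  · refine ae_cellMeasure_of_forall fun x hx t ht => ?_
    rw [norm_mul, norm_expMode, mul_one, Complex.norm_real]
    exact hC x hx t ⟨ht.1.le, ht.2.le⟩
  · refine ae_of_all _ fun x t ht => HasDerivAt.mul_const ?_ _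
    rw [dyWithin_eq_dy v (p := (x, t)) ht.1]
    have h1 : HasDerivAt (fun t => v (x, t)) (dy v (x, t)) t :=
      (hv.differentiableAt (p := (x, t)) ht.1).hasFDerivAt.comp_hasDerivAt t
        ((hasDerivAt_const t x).prodMk (hasDerivAt_id t))
    exact h1.ofReal_comp

theorem SmoothPeriodic.contDiff_slice {N : ℕ} {T : ℝ} {v : EuclideanSpace ℝ (Fin N) × ℝ → ℝ}
    (hv : SmoothPeriodic T v) {y : ℝ} (hy : 0 < y) : ContDiff ℝ 1 fun x => v (x, y) := by
  have h : ContDiffOn ℝ 1 (fun x => v (x, y)) univ :=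
    (hv.contDiffOn_upper.of_le (by simp)).comp
      (contDiff_id.prodMk contDiff_const).contDiffOn fun x _ => hy
  exact contDiffOn_univ.1 h

theorem SmoothPeriodic.fderiv_slice {N : ℕ} {T : ℝ} {v : EuclideanSpace ℝ (Fin N) × ℝ → ℝ}
    (hv : SmoothPeriodic T v) {y : ℝ} (hy : 0 < y) (x : EuclideanSpace ℝ (Fin N)) (i : Fin N) :
    fderiv ℝ (fun x => v (x, y)) x (EuclideanSpace.single i 1) = dx i v (x, y) := by
  have h1 := (hv.differentiableAt (p := (x, y)) hy).hasFDerivAt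
  have h2 : HasFDerivAt (fun x => v (x, y)) _ x :=
    HasFDerivAt.comp (f := fun x => (x, y)) x h1 ((hasFDerivAt_id x).prodMk (hasFDerivAt_const y x))
  rw [h2.fderiv, dx]
  simp

theorem SmoothPeriodic.continuous_dx_slice {N : ℕ} {T : ℝ}
    {v : EuclideanSpace ℝ (Fin N) × ℝ → ℝ} (hv : SmoothPeriodic T v) {y : ℝ} (hy : 0 < y)
    (i : Fin N) : Continuous fun x => dx i v (x, y) := by
  simp_rw [← hv.fderiv_slice hy]
  exact ((hv.contDiff_slice hy).continuous_fderiv one_ne_zero).clm_apply continuous_const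

theorem SmoothPeriodic.continuous_dy_slice {N : ℕ} {T : ℝ}
    {v : EuclideanSpace ℝ (Fin N) × ℝ → ℝ} (hv : SmoothPeriodic T v) {y : ℝ} (hy : 0 < y) :
    Continuous fun x => dy v (x, y) :=
  (continuous_slice hv.continuousOn_dyWithin hy.le).congr fun x => dyWithin_eq_dy v (p := (x, y)) hy

/-- On each slice, the Fourier coefficients are controlled by the Dirichlet integral. -/
theorem SmoothPeriodic.sum_coef_slice_le {N : ℕ} {m T : ℝ} (hT : 0 < T)
    {v : EuclideanSpace ℝ (Fin N) × ℝ → ℝ} (hv : SmoothPeriodic T v) (F : Finset (Fin N → ℤ))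
    {y : ℝ} (hy : 0 < y) :
    ∑ k ∈ F, (symb m T k * ‖coef T (fun x => (v (x, y) : ℂ)) k‖ ^ 2 +
        ‖coef T (fun x => (dyWithin v (x, y) : ℂ)) k‖ ^ 2) ≤
      ∫ x, ((∑ i, dx i v (x, y) * dx i v (x, y)) + dy v (x, y) * dy v (x, y) +
        m ^ 2 * (v (x, y) * v (x, y))) ∂(cellMeasure N T) := by
  have hc := hv.contDiff_slice hy
  have hdx := hv.continuous_dx_slice hy
  have hdy := hv.continuous_dy_slice hy
  -- The coefficients of the partial derivatives are iωk_j c_k, so their squared moduli sum to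
  -- ω²|k|²|c_k|².
  have hterm : ∀ k : Fin N → ℤ, symb m T k * ‖coef T (fun x => (v (x, y) : ℂ)) k‖ ^ 2 =
      ∑ i, ‖coef T (fun x => (dx i v (x, y) : ℂ)) k‖ ^ 2 +
        m ^ 2 * ‖coef T (fun x => (v (x, y) : ℂ)) k‖ ^ 2 := by
    intro k
    rw [symb, add_mul, Finset.mul_sum, Finset.sum_mul]
    congr 1
    refine Finset.sum_congr rfl fun i _ => ?_
    simp_rw [← hv.fderiv_slice hy]
    rw [coef_fderiv_single hT hc i (fun x => hv.periodic i x y hy.le), norm_mul, norm_mul,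
      Complex.norm_I, Complex.norm_real, Real.norm_eq_abs, one_mul, mul_pow, sq_abs, mul_pow]
  simp_rw [hterm, dyWithin_eq_dy v (show 0 < (_, y).2 from hy)]
  have hi : ∀ {f : EuclideanSpace ℝ (Fin N) → ℝ}, Continuous f →
      Integrable f (cellMeasure N T) := integrable_of_continuous
  have hcs : Continuous fun x => ∑ i, dx i v (x, y) * dx i v (x, y) :=
    continuous_finsetSum _ fun i _ => (hdx i).mul (hdx i)
  have hv2 : Continuous fun x => m ^ 2 * (v (x, y) * v (x, y)) :=
    continuous_const.mul (hc.continuous.mul hc.continuous)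
  have hdy2 : Continuous fun x => dy v (x, y) * dy v (x, y) := hdy.mul hdy
  have hdx2 : ∀ i, Continuous fun x => dx i v (x, y) * dx i v (x, y) := fun i => (hdx i).mul (hdx i)
  have hcs2 : Continuous fun x => (∑ i, dx i v (x, y) * dx i v (x, y)) +
      dy v (x, y) * dy v (x, y) := hcs.add hdy2
  rw [integral_add (hi hcs2) (hi hv2),
    integral_add (hi hcs) (hi hdy2),
    integral_finsetSum _ fun i _ => hi (hdx2 i), integral_const_mul,
    Finset.sum_add_distrib, Finset.sum_add_distrib, ← Finset.mul_sum, Finset.sum_comm]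
  have h1 := Finset.sum_le_sum fun i (_ : i ∈ Finset.univ) => sum_sq_coef_le hT (hdx i) F
  have h2 := mul_le_mul_of_nonneg_left (sum_sq_coef_le hT hc.continuous F) (sq_nonneg m)
  have h3 := sum_sq_coef_le hT hdy F
  linarith

theorem volume_restrict_halfCylinder (N : ℕ) (T : ℝ) :
    (volume : Measure (EuclideanSpace ℝ (Fin N) × ℝ)).restrict (halfCylinder N T) =
      (cellMeasure N T).prod (volume.restrict (Ioi 0)) := by
  rw [cellMeasure, Measure.prod_restrict]; rfl

/-- The trace inequality `|v(·,0)|_H ≤ C ‖v‖` on finitely many Fourier modes. -/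
theorem TestFun.sum_symb_mul_le {N : ℕ} {s m T : ℝ} (hs0 : 0 < s) (hs1 : s < 1) (hm : 0 < m)
    (hT : 0 < T) (v : TestFun N s m T) (F : Finset (Fin N → ℤ)) :
    ∑ k ∈ F, symb m T k ^ s * ‖coef T (fun x => (v.toFun (x, 0) : ℂ)) k‖ ^ 2 ≤
      (4 + 1 / s) * ‖v‖ ^ 2 := by
  have hv := v.mem.1
  have hK : 0 ≤ 4 + 1 / s := by positivity
  have h1 : ∀ k : Fin N → ℤ,
      ENNReal.ofReal (symb m T k ^ s * ‖coef T (fun x => (v.toFun (x, 0) : ℂ)) k‖ ^ 2) ≤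
      ENNReal.ofReal (4 + 1 / s) * ∫⁻ y in Ioi (0 : ℝ), ENNReal.ofReal (y ^ (1 - 2 * s) *
        (symb m T k * ‖coef T (fun x => (v.toFun (x, y) : ℂ)) k‖ ^ 2 +
          ‖coef T (fun x => (dyWithin v.toFun (x, y) : ℂ)) k‖ ^ 2)) := by
    intro k
    -- The scale l = λ_k makes l² = λ_k² the factor in front of |c_k|² and turns (l²)^s into the
    -- weight of H.
    have hl : 0 < √(symb m T k) := Real.sqrt_pos.2 (symb_pos hm T k)
    have := trace_bound_scaled hs0 hs1 hl
      (continuousOn_coef_slice T hv.contDiffOn.continuousOn k _)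
      (continuousOn_coef_slice T hv.continuousOn_dyWithin k _)
      (fun y hy => hv.hasDerivAt_coef_slice k hy.1)
    rwa [Real.sq_sqrt (symb_pos hm T k).le] at this
  have hnn : ∀ k : Fin N → ℤ, ∀ y : ℝ, 0 ≤ symb m T k * ‖coef T (fun x => (v.toFun (x, y) : ℂ)) k‖ ^ 2 +
      ‖coef T (fun x => (dyWithin v.toFun (x, y) : ℂ)) k‖ ^ 2 := fun k y =>
    add_nonneg (mul_nonneg (symb_pos hm T k).le (sq_nonneg _)) (sq_nonneg _)
  have hcontIci : ∀ {G : EuclideanSpace ℝ (Fin N) × ℝ → ℝ}, ContinuousOn G {p | 0 ≤ p.2} →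
      ∀ k : Fin N → ℤ, ContinuousOn (fun y => coef T (fun x => (G (x, y) : ℂ)) k) (Ioi 0) := by
    intro G hG k y hy
    exact ((continuousOn_coef_slice T hG k (y + 1)).continuousAt
      (Icc_mem_nhds hy (by linarith))).continuousWithinAt
  have hmeas : ∀ k : Fin N → ℤ, AEMeasurable (fun y : ℝ => ENNReal.ofReal (y ^ (1 - 2 * s) *
        (symb m T k * ‖coef T (fun x => (v.toFun (x, y) : ℂ)) k‖ ^ 2 +
          ‖coef T (fun x => (dyWithin v.toFun (x, y) : ℂ)) k‖ ^ 2))) (volume.restrict (Ioi 0)) := by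
    intro k
    refine (ContinuousOn.aemeasurable ?_ measurableSet_Ioi).ennreal_ofReal
    refine ContinuousOn.mul (continuousOn_id.rpow_const fun y hy => Or.inl (ne_of_gt hy)) ?_
    exact (continuousOn_const.mul ((hcontIci hv.contDiffOn.continuousOn k).norm.pow 2)).add
      ((hcontIci hv.continuousOn_dyWithin k).norm.pow 2)
  -- Tonelli with y as outer variable, because Bessel's inequality is available slice by slice.
  have hen : ENNReal.ofReal (‖v‖ ^ 2) = ∫⁻ y in Ioi (0 : ℝ), ∫⁻ x,
      ENNReal.ofReal (energyDensity s m v.toFun v.toFun (x, y)) ∂(cellMeasure N T) := by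
    have hm' := (hv.aestronglyMeasurable (s := s) (m := m) hv).aemeasurable.ennreal_ofReal
    rw [norm_sq_testFun, ofReal_integral_eq_lintegral_ofReal v.mem.2
      ((ae_restrict_iff' (isOpen_halfCylinder N T).measurableSet).2 (ae_of_all _ fun p hp =>
        energyDensity_self_nonneg s m _ hp.2))]
    rw [volume_restrict_halfCylinder] at hm' ⊢
    rw [lintegral_prod_symm _ hm']
  have hslice : ∀ y ∈ Ioi (0 : ℝ), ∑ k ∈ F, ENNReal.ofReal (y ^ (1 - 2 * s) *
        (symb m T k * ‖coef T (fun x => (v.toFun (x, y) : ℂ)) k‖ ^ 2 +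
          ‖coef T (fun x => (dyWithin v.toFun (x, y) : ℂ)) k‖ ^ 2)) ≤
      ∫⁻ x, ENNReal.ofReal (energyDensity s m v.toFun v.toFun (x, y)) ∂(cellMeasure N T) := by
    intro y hy
    have hy0 : 0 ≤ y ^ (1 - 2 * s) := Real.rpow_nonneg (le_of_lt hy) _
    rw [← ENNReal.ofReal_sum_of_nonneg fun k _ => mul_nonneg hy0 (hnn k y), ← Finset.mul_sum]
    refine (ENNReal.ofReal_le_ofReal (mul_le_mul_of_nonneg_left
      (hv.sum_coef_slice_le (m := m) hT F hy) hy0)).trans ?_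
    rw [← integral_const_mul]
    have hc := hv.contDiff_slice hy
    have hcont : Continuous fun x => energyDensity s m v.toFun v.toFun (x, y) := by
      have h1 := hv.continuous_dx_slice hy
      have h2 := hv.continuous_dy_slice hy
      have h3 := hc.continuous
      simp only [energyDensity]
      refine Continuous.mul continuous_const ?_
      fun_prop
    exact (ofReal_integral_eq_lintegral_ofReal (integrable_of_continuous hcont)
      (ae_of_all _ fun x => energyDensity_self_nonneg s m v.toFun (p := (x, y)) hy)).le
  -- In extended nonnegative reals the finite sum and the y-integral are exchanged without checking
  -- that each mode is integrable.
  rw [← ENNReal.ofReal_le_ofReal_iff (by positivity),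
    ENNReal.ofReal_sum_of_nonneg fun k _ => mul_nonneg
      (Real.rpow_nonneg (symb_pos hm T k).le _) (sq_nonneg _), ENNReal.ofReal_mul hK, hen]
  refine (Finset.sum_le_sum fun k _ => h1 k).trans ?_
  rw [← Finset.mul_sum, ← lintegral_finsetSum' _ fun k _ => hmeas k]
  exact mul_le_mul_right (setLIntegral_mono' measurableSet_Ioi hslice) _

/-! ### The trace inequality on the completion -/

theorem fourierCoef_Tr_coe {N : ℕ} {s m T : ℝ} (hs0 : 0 < s) (hs1 : s < 1) (hm : 0 < m)
    (v : TestFun N s m T) (k : Fin N → ℤ) : fourierCoef (Tr N s m T hs0 hs1 hm v) k =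
      coef T (fun x => (v.toFun (x, 0) : ℂ)) k := by
  rw [fourierCoef_eq_coef]
  exact coef_congr_ae ((Tr_coe N s m T hs0 hs1 hm v).mono fun x hx => by simp only [hx]) k

/-- For a fixed finite F both sides are continuous in v, so the inequality is a closed condition and
passes from test functions to the completion. Finiteness of F matters: continuity of the full sum is
not known at this stage. -/
theorem sum_hTerm_Tr_le {N : ℕ} {s m T : ℝ} (hs0 : 0 < s) (hs1 : s < 1) (hm : 0 < m)
    (hT : 0 < T) (v : X N s m T) (F : Finset (Fin N → ℤ)) :
    ∑ k ∈ F, hTerm s m (Tr N s m T hs0 hs1 hm v) k ≤ (4 + 1 / s) * ‖v‖ ^ 2 := by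
  refine UniformSpace.Completion.induction_on v (isClosed_le ?_ ?_) fun v => ?_
  · refine continuous_finsetSum _ fun k _ => continuous_const.mul (Continuous.pow ?_ 2)
    exact ((fourierCoefCLM hT k).continuous.comp (Tr N s m T hs0 hs1 hm).continuous).norm
  · fun_prop
  · simp_rw [hTerm_eq, fourierCoef_Tr_coe, UniformSpace.Completion.norm_coe]
    exact v.sum_symb_mul_le hs0 hs1 hm hT F

theorem Tr_mem_H {N : ℕ} {s m T : ℝ} (hs0 : 0 < s) (hs1 : s < 1) (hm : 0 < m)
    (hT : 0 < T) (v : X N s m T) : Tr N s m T hs0 hs1 hm v ∈ H N s m T :=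
  summable_of_sum_le (fun k => hTerm_nonneg hm _ k) (sum_hTerm_Tr_le hs0 hs1 hm hT v)

theorem hNorm_Tr_le {N : ℕ} {s m T : ℝ} (hs0 : 0 < s) (hs1 : s < 1) (hm : 0 < m)
    (hT : 0 < T) (v : X N s m T) :
    hNorm s m (Tr N s m T hs0 hs1 hm v) ≤ √(4 + 1 / s) * ‖v‖ := by
  have h := (Tr_mem_H hs0 hs1 hm hT v).tsum_le_of_sum_le (sum_hTerm_Tr_le hs0 hs1 hm hT v)
  rw [hNorm, ← Real.sqrt_sq (norm_nonneg v), ← Real.sqrt_mul (by positivity)]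
  exact Real.sqrt_le_sqrt h

/-! ### Extending a single mode by exponential decay -/

/-- The real wave `Re (a exp(i ω k·x))`. -/
noncomputable def wave {N : ℕ} (T : ℝ) (k : Fin N → ℤ) (a : ℂ) (x : EuclideanSpace ℝ (Fin N)) : ℝ :=
  (a * expMode T k x).re

theorem contDiff_wave {N : ℕ} (T : ℝ) (k : Fin N → ℤ) (a : ℂ) {n : WithTop ℕ∞} :
    ContDiff ℝ n (wave T k a) :=
  Complex.reCLM.contDiff.comp (contDiff_const.mul (contDiff_expMode T k))

theorem abs_wave_le {N : ℕ} (T : ℝ) (k : Fin N → ℤ) (a : ℂ) (x : EuclideanSpace ℝ (Fin N)) :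
    |wave T k a x| ≤ ‖a‖ := by
  refine (Complex.abs_re_le_norm _).trans ?_
  rw [norm_mul, norm_expMode, mul_one]

theorem fderiv_wave_single {N : ℕ} (T : ℝ) (k : Fin N → ℤ) (a : ℂ) (x : EuclideanSpace ℝ (Fin N))
    (i : Fin N) : fderiv ℝ (wave T k a) x (EuclideanSpace.single i 1) =
      wave T k (Complex.I * ((2 * Real.pi / T * k i : ℝ) : ℂ) * a) x := by
  have h := Complex.reCLM.hasFDerivAt.comp x
    ((((contDiff_expMode T k (n := 1)).differentiable one_ne_zero) x).hasFDerivAt.const_mul a)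
  have h2 : HasFDerivAt (wave T k a) _ x := h
  rw [h2.fderiv, ContinuousLinearMap.comp_apply, smul_apply, fderiv_expMode_single,
    Complex.reCLM_apply, wave]
  congr 1
  rw [smul_eq_mul]
  ring

theorem ofReal_wave {N : ℕ} (T : ℝ) (k : Fin N → ℤ) (a : ℂ) (x : EuclideanSpace ℝ (Fin N)) :
    (wave T k a x : ℂ) =
      a / 2 * expMode T k x + (starRingEnd ℂ) a / 2 * expMode T (-k) x := by
  rw [wave, Complex.re_eq_add_conj, map_mul, conj_expMode]
  ring

/-- A real wave carries both frequencies k and -k, each with half its amplitude. For k = l = 0 both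
terms are present and add up to the real part of a. -/
theorem coef_wave {N : ℕ} {T : ℝ} (hT : 0 < T) (k : Fin N → ℤ) (a : ℂ) (l : Fin N → ℤ) :
    coef T (fun x => (wave T k a x : ℂ)) l =
      (if k = l then (√(T ^ N) : ℂ) * (a / 2) else 0) +
        if k = -l then (√(T ^ N) : ℂ) * ((starRingEnd ℂ) a / 2) else 0 := by
  simp_rw [ofReal_wave]
  rw [coef_add ((integrable_expMode T k).const_mul _) ((integrable_expMode T (-k)).const_mul _),
    coef_const_mul, coef_const_mul, coef_expMode hT, coef_expMode hT]
  simp only [neg_eq_iff_eq_neg]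
  split_ifs <;> ring

/-- The product contains only the frequencies ±(k + l) and ±(k - l), none of which is zero. -/
theorem integral_wave_mul_wave {N : ℕ} {T : ℝ} (hT : 0 < T) {k l : Fin N → ℤ} (a b : ℂ)
    (h1 : l ≠ k) (h2 : l ≠ -k) :
    ∫ x, wave T k a x * wave T l b x ∂(cellMeasure N T) = 0 := by
  have h : ∀ x : EuclideanSpace ℝ (Fin N), wave T k a x * wave T l b x =
      (a * b / 2 * expMode T (k + l) x + a * (starRingEnd ℂ) b / 2 * expMode T (k - l) x).re := by
    intro x
    have e : a * b / 2 * expMode T (k + l) x + a * (starRingEnd ℂ) b / 2 * expMode T (k - l) x =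
        (a * expMode T k x) * ((wave T l b x : ℝ) : ℂ) := by
      rw [ofReal_wave, sub_eq_add_neg, expMode_add, expMode_add]
      ring
    rw [e, Complex.re_mul_ofReal, wave, wave]
  have hint : ∀ (c : ℂ) (j : Fin N → ℤ), Integrable (fun x => c * expMode T j x) (cellMeasure N T) :=
    fun c j => (integrable_expMode T j).const_mul c
  simp_rw [h]
  have h3 : k + l ≠ 0 := fun h => h2 (eq_neg_of_add_eq_zero_right h)
  have h4 : k - l ≠ 0 := fun h => h1 (sub_eq_zero.1 h).symm
  have := integral_re ((hint (a * b / 2) (k + l)).add (hint (a * (starRingEnd ℂ) b / 2) (k - l)))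
  simp only [Pi.add_apply, RCLike.re_eq_complex_re] at this
  rw [this, integral_add (hint _ _) (hint _ _), integral_const_mul, integral_const_mul,
    integral_expMode hT, integral_expMode hT, if_neg h3, if_neg h4]
  simp

/-- The exponentially decaying extension of a wave. -/
noncomputable def decayingWave {N : ℕ} (m T : ℝ) (k : Fin N → ℤ) (a : ℂ)
    (p : EuclideanSpace ℝ (Fin N) × ℝ) : ℝ :=
  wave T k a p.1 * Real.exp (-(√(symb m T k) * p.2))

theorem contDiff_decayingWave {N : ℕ} (m T : ℝ) (k : Fin N → ℤ) (a : ℂ) {n : WithTop ℕ∞} :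
    ContDiff ℝ n (decayingWave m T k a) :=
  ((contDiff_wave T k a).comp contDiff_fst).mul (contDiff_const.mul contDiff_snd).neg.exp

theorem smoothPeriodic_decayingWave {N : ℕ} (m : ℝ) {T : ℝ} (hT : 0 < T) (k : Fin N → ℤ) (a : ℂ) :
    SmoothPeriodic T (decayingWave m T k a) :=
  ⟨(contDiff_decayingWave m T k a).contDiffOn, fun i x y _ => by
    simp only [decayingWave, wave, expMode_add_single hT]⟩

theorem hasFDerivAt_decayingWave {N : ℕ} (m T : ℝ) (k : Fin N → ℤ) (a : ℂ)
    (p : EuclideanSpace ℝ (Fin N) × ℝ) :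
    HasFDerivAt (decayingWave m T k a)
      (wave T k a p.1 • Real.exp (-(√(symb m T k) * p.2)) •
          (-(√(symb m T k) • ContinuousLinearMap.snd ℝ (EuclideanSpace ℝ (Fin N)) ℝ)) +
        Real.exp (-(√(symb m T k) * p.2)) •
          (fderiv ℝ (wave T k a) p.1).comp (ContinuousLinearMap.fst ℝ _ ℝ)) p := by
  have h1 := (((contDiff_wave T k a (n := 1)).differentiable one_ne_zero) p.1).hasFDerivAt.comp p
    (hasFDerivAt_fst (𝕜 := ℝ) (p := p))
  have h2 := ((hasFDerivAt_snd (𝕜 := ℝ) (p := p)).const_mul (√(symb m T k))).neg.exp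
  exact h1.mul h2

theorem dx_decayingWave {N : ℕ} (m T : ℝ) (k : Fin N → ℤ) (a : ℂ)
    (p : EuclideanSpace ℝ (Fin N) × ℝ) (i : Fin N) :
    dx i (decayingWave m T k a) p =
      wave T k (Complex.I * ((2 * Real.pi / T * k i : ℝ) : ℂ) * a) p.1 *
        Real.exp (-(√(symb m T k) * p.2)) := by
  rw [dx, (hasFDerivAt_decayingWave m T k a p).fderiv, ← fderiv_wave_single]
  simp [mul_comm]

theorem dy_decayingWave {N : ℕ} (m T : ℝ) (k : Fin N → ℤ) (a : ℂ)
    (p : EuclideanSpace ℝ (Fin N) × ℝ) :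
    dy (decayingWave m T k a) p =
      -√(symb m T k) * (wave T k a p.1 * Real.exp (-(√(symb m T k) * p.2))) := by
  rw [dy, (hasFDerivAt_decayingWave m T k a p).fderiv]
  simp
  ring

/-- The `x`-dependent factor of the energy density of two decaying waves. -/
noncomputable def waveEnergy {N : ℕ} (m T : ℝ) (k l : Fin N → ℤ) (a b : ℂ)
    (x : EuclideanSpace ℝ (Fin N)) : ℝ :=
  (∑ i, wave T k (Complex.I * ((2 * Real.pi / T * k i : ℝ) : ℂ) * a) x *
      wave T l (Complex.I * ((2 * Real.pi / T * l i : ℝ) : ℂ) * b) x) +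
    (√(symb m T k) * √(symb m T l) + m ^ 2) * (wave T k a x * wave T l b x)

/-- Separation of variables: the density factors, so inner products factor too, and orthogonality is
decided by the x-integral alone. -/
theorem energyDensity_decayingWave {N : ℕ} (s m T : ℝ) (k l : Fin N → ℤ) (a b : ℂ)
    (p : EuclideanSpace ℝ (Fin N) × ℝ) :
    energyDensity s m (decayingWave m T k a) (decayingWave m T l b) p =
      waveEnergy m T k l a b p.1 *
        (p.2 ^ (1 - 2 * s) * Real.exp (-((√(symb m T k) + √(symb m T l)) * p.2))) := by
  have he : Real.exp (-((√(symb m T k) + √(symb m T l)) * p.2)) =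
      Real.exp (-(√(symb m T k) * p.2)) * Real.exp (-(√(symb m T l) * p.2)) := by
    rw [← Real.exp_add]; ring_nf
  simp only [energyDensity, dx_decayingWave, dy_decayingWave, waveEnergy, he]
  have hs : ∑ i, wave T k (Complex.I * ((2 * Real.pi / T * k i : ℝ) : ℂ) * a) p.1 *
        Real.exp (-(√(symb m T k) * p.2)) *
        (wave T l (Complex.I * ((2 * Real.pi / T * l i : ℝ) : ℂ) * b) p.1 *
        Real.exp (-(√(symb m T l) * p.2))) =
      (∑ i, wave T k (Complex.I * ((2 * Real.pi / T * k i : ℝ) : ℂ) * a) p.1 *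
        wave T l (Complex.I * ((2 * Real.pi / T * l i : ℝ) : ℂ) * b) p.1) *
        (Real.exp (-(√(symb m T k) * p.2)) * Real.exp (-(√(symb m T l) * p.2))) := by
    rw [Finset.sum_mul]
    exact Finset.sum_congr rfl fun i _ => by ring
  rw [hs]
  simp only [decayingWave]
  ring

theorem continuous_waveEnergy {N : ℕ} (m T : ℝ) (k l : Fin N → ℤ) (a b : ℂ) :
    Continuous (waveEnergy m T k l a b) := by
  have h : ∀ (k : Fin N → ℤ) a, Continuous (wave T k a) := fun k a =>
    (contDiff_wave T k a (n := 0)).continuous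
  exact (continuous_finsetSum _ fun i _ => (h k _).mul (h l _)).add
    (continuous_const.mul ((h k _).mul (h l _)))

theorem integrableOn_rpow_mul_exp {s : ℝ} (hs1 : s < 1) {c : ℝ} (hc : 0 < c) :
    IntegrableOn (fun y : ℝ => y ^ (1 - 2 * s) * Real.exp (-(c * y))) (Ioi 0) := by
  have h := integrableOn_rpow_mul_exp_neg_mul_rpow (s := 1 - 2 * s) (p := 1) (b := c)
    (by linarith) one_pos hc
  simpa using h

theorem decayingWave_mem {N : ℕ} {s m T : ℝ} (hs1 : s < 1) (hm : 0 < m) (hT : 0 < T)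
    (k : Fin N → ℤ) (a : ℂ) : decayingWave m T k a ∈ testSpace N s m T := by
  refine ⟨smoothPeriodic_decayingWave m hT k a, ?_⟩
  have hl : 0 < √(symb m T k) := Real.sqrt_pos.2 (symb_pos hm T k)
  rw [IntegrableOn, volume_restrict_halfCylinder]
  have h := (integrable_of_continuous (T := T) (continuous_waveEnergy m T k k a a)).mul_prod
    (integrableOn_rpow_mul_exp hs1 (add_pos hl hl))
  exact h.congr (ae_of_all _ fun p => (energyDensity_decayingWave s m T k k a a p).symm)

/-- A decaying wave as a test function. -/
noncomputable def testWave {N : ℕ} {s m T : ℝ} (hs1 : s < 1) (hm : 0 < m) (hT : 0 < T)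
    (k : Fin N → ℤ) (a : ℂ) : TestFun N s m T :=
  (⟨decayingWave m T k a, decayingWave_mem hs1 hm hT k a⟩ : testSpace N s m T)

theorem toFun_testWave {N : ℕ} {s m T : ℝ} (hs1 : s < 1) (hm : 0 < m) (hT : 0 < T)
    (k : Fin N → ℤ) (a : ℂ) :
    (testWave (s := s) hs1 hm hT k a).toFun = decayingWave m T k a := rfl

theorem inner_testWave {N : ℕ} {s m T : ℝ} (hs1 : s < 1) (hm : 0 < m) (hT : 0 < T)
    (k l : Fin N → ℤ) (a b : ℂ) :
    inner ℝ (testWave (s := s) hs1 hm hT k a) (testWave hs1 hm hT l b) =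
      (∫ x, waveEnergy m T k l a b x ∂(cellMeasure N T)) * ∫ y in Ioi (0 : ℝ),
        y ^ (1 - 2 * s) * Real.exp (-((√(symb m T k) + √(symb m T l)) * y)) := by
  change ∫ p in halfCylinder N T, energyDensity s m (decayingWave m T k a) (decayingWave m T l b) p = _
  simp_rw [volume_restrict_halfCylinder, energyDensity_decayingWave]
  exact integral_prod_mul (waveEnergy m T k l a b) (fun y : ℝ =>
    y ^ (1 - 2 * s) * Real.exp (-((√(symb m T k) + √(symb m T l)) * y)))

/-- Differentiating in x changes the amplitude of a wave but not its frequency, so every term of the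
energy is a product of orthogonal waves. -/
theorem inner_testWave_eq_zero {N : ℕ} {s m T : ℝ} (hs1 : s < 1) (hm : 0 < m) (hT : 0 < T)
    {k l : Fin N → ℤ} (a b : ℂ) (h1 : l ≠ k) (h2 : l ≠ -k) :
    inner ℝ (testWave (s := s) hs1 hm hT k a) (testWave hs1 hm hT l b) = 0 := by
  have hc : ∀ a b : ℂ, Integrable (fun x => wave T k a x * wave T l b x) (cellMeasure N T) :=
    fun a b => integrable_of_continuous
      ((contDiff_wave T k a (n := 0)).continuous.mul (contDiff_wave T l b (n := 0)).continuous)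
  rw [inner_testWave]
  unfold waveEnergy
  rw [integral_add (integrable_finsetSum _ fun i _ => hc _ _) ((hc _ _).const_mul _),
    integral_finsetSum _ fun i _ => hc _ _, integral_const_mul]
  simp [integral_wave_mul_wave hT _ _ h1 h2]

/-- The x-integral is of order λ²|a|², and the integral of y^{1-2s} exp(-2λy) is a Gamma value times
(2λ)^{-(2-2s)}; together they give λ^{2s}|a|². -/
theorem norm_sq_testWave_le {N : ℕ} {s m T : ℝ} (hs1 : s < 1) (hm : 0 < m) (hT : 0 < T)
    (k : Fin N → ℤ) (a : ℂ) :
    ‖testWave (s := s) hs1 hm hT k a‖ ^ 2 ≤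
      2 * (cellMeasure N T).real univ * (Real.Gamma (2 - 2 * s) * (1 / 2) ^ (2 - 2 * s)) *
        (symb m T k ^ s * ‖a‖ ^ 2) := by
  set L := symb m T k with hL
  have hL0 : 0 < L := symb_pos hm T k
  have hl : 0 < √L := Real.sqrt_pos.2 hL0
  rw [← real_inner_self_eq_norm_sq, inner_testWave]
  have hx : ∫ x, waveEnergy m T k k a a x ∂(cellMeasure N T) ≤
      2 * L * ‖a‖ ^ 2 * (cellMeasure N T).real univ := by
    have hb : ∀ x, waveEnergy m T k k a a x ≤ 2 * L * ‖a‖ ^ 2 := by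
      intro x
      have hw : ∀ b : ℂ, wave T k b x * wave T k b x ≤ ‖b‖ ^ 2 := fun b => by
        rw [← abs_mul_abs_self, ← sq]
        exact pow_le_pow_left₀ (abs_nonneg _) (abs_wave_le T k b x) 2
      have h1 : ∑ i, wave T k (Complex.I * ((2 * Real.pi / T * k i : ℝ) : ℂ) * a) x *
          wave T k (Complex.I * ((2 * Real.pi / T * k i : ℝ) : ℂ) * a) x ≤
          ((2 * Real.pi / T) ^ 2 * ∑ i, (k i : ℝ) ^ 2) * ‖a‖ ^ 2 := by
        rw [Finset.mul_sum, Finset.sum_mul]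
        refine Finset.sum_le_sum fun i _ => (hw _).trans (le_of_eq ?_)
        rw [norm_mul, norm_mul, Complex.norm_I, Complex.norm_real, Real.norm_eq_abs, one_mul,
          mul_pow, sq_abs, mul_pow]
      have h2 : (√L * √L + m ^ 2) * (wave T k a x * wave T k a x) ≤ (L + m ^ 2) * ‖a‖ ^ 2 := by
        rw [Real.mul_self_sqrt hL0.le]
        exact mul_le_mul_of_nonneg_left (hw a) (by positivity)
      -- One copy of L is spent as L = ω²|k|² + m²: the first summand pays for the x-gradient, while
      -- m² and the other L pay for the mass term and the y-derivative.
      have h3 : 2 * L * ‖a‖ ^ 2 = ((2 * Real.pi / T) ^ 2 * ∑ i, (k i : ℝ) ^ 2) * ‖a‖ ^ 2 +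
          (L + m ^ 2) * ‖a‖ ^ 2 := by
        conv_lhs => rw [two_mul]
        nth_rewrite 1 [hL]
        rw [symb]
        ring
      rw [waveEnergy, h3]
      exact add_le_add h1 h2
    refine (integral_mono (integrable_of_continuous (continuous_waveEnergy m T k k a a))
      (integrable_const _) hb).trans ?_
    rw [integral_const, smul_eq_mul, mul_comm]
  have hy : ∫ y in Ioi (0 : ℝ), y ^ (1 - 2 * s) * Real.exp (-((√L + √L) * y)) =
      (1 / (√L + √L)) ^ (2 - 2 * s) * Real.Gamma (2 - 2 * s) := by
    rw [← Real.integral_rpow_mul_exp_neg_mul_Ioi (by linarith) (add_pos hl hl)]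
    congr 2; ext y; congr 2; ring
  rw [hy]
  have hG : 0 < Real.Gamma (2 - 2 * s) := Real.Gamma_pos_of_pos (by linarith)
  refine (mul_le_mul_of_nonneg_right hx (by positivity)).trans (le_of_eq ?_)
  have hsq : (1 / (√L + √L)) ^ (2 - 2 * s) = (1 / 2) ^ (2 - 2 * s) * (L ^ s / L) := by
    have e : 1 / (√L + √L) = 1 / 2 * L ^ (-(1 / 2) : ℝ) := by
      rw [Real.rpow_neg hL0.le, ← Real.sqrt_eq_rpow]; field_simp; ring
    rw [e, Real.mul_rpow (by norm_num) (Real.rpow_nonneg hL0.le _), ← Real.rpow_mul hL0.le,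
      ← Real.rpow_sub_one hL0.ne']
    congr 2; ring
  rw [hsq]
  field_simp

/-! ### Summing the extended modes: surjectivity of the trace -/

/-- A Bessel-type estimate for families that are orthogonal up to an involution of the indices. -/
theorem norm_sum_sq_le_of_inner_eq_zero {ι E : Type*} [InvolutiveNeg ι] [SeminormedAddCommGroup E]
    [InnerProductSpace ℝ E] {g : ι → E} {B : ι → ℝ} (hB : ∀ k, ‖g k‖ ^ 2 ≤ B k)
    (hneg : ∀ k, B (-k) = B k) (horth : ∀ k l, l ≠ k → l ≠ -k → inner ℝ (g k) (g l) = 0)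
    (F : Finset ι) : ‖∑ k ∈ F, g k‖ ^ 2 ≤ 2 * ∑ k ∈ F, B k := by
  classical
  have hB0 : ∀ k, 0 ≤ B k := fun k => (sq_nonneg _).trans (hB k)
  rw [← real_inner_self_eq_norm_sq, sum_inner, Finset.mul_sum]
  refine Finset.sum_le_sum fun k _ => ?_
  rw [inner_sum]
  have h1 : ∀ l ∈ F, inner ℝ (g k) (g l) ≤
      (if l = k then B k else 0) + if l = -k then B k else 0 := by
    intro l _
    -- Cauchy–Schwarz and 2xy ≤ x² + y². For each k this is used only at l = k and l = -k, which
    -- explains the factor 2 in the conclusion.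
    have hkl : ∀ l, B l = B k → inner ℝ (g k) (g l) ≤ B k := fun l hl => by
      have := real_inner_le_norm (g k) (g l)
      have h2 := hB l
      rw [hl] at h2
      nlinarith [hB k, sq_nonneg (‖g k‖ - ‖g l‖)]
    by_cases h : l = k
    · subst h
      have : 0 ≤ if l = -l then B l else 0 := by split_ifs; exacts [hB0 l, le_rfl]
      rw [if_pos rfl]
      linarith [hkl l rfl]
    · by_cases h' : l = -k
      · rw [if_neg h, if_pos h', zero_add]
        exact hkl l (by rw [h', hneg])
      · rw [if_neg h, if_neg h', horth k l h h', add_zero]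
  refine (Finset.sum_le_sum h1).trans ?_
  rw [Finset.sum_add_distrib, Finset.sum_ite_eq', Finset.sum_ite_eq']
  have := hB0 k
  split_ifs <;> linarith

theorem summable_of_inner_eq_zero {ι E : Type*} [InvolutiveNeg ι] [SeminormedAddCommGroup E]
    [InnerProductSpace ℝ E] [CompleteSpace E] {g : ι → E} {B : ι → ℝ} (hB : ∀ k, ‖g k‖ ^ 2 ≤ B k)
    (hneg : ∀ k, B (-k) = B k) (horth : ∀ k l, l ≠ k → l ≠ -k → inner ℝ (g k) (g l) = 0)
    (hsum : Summable B) : Summable g := by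
  rw [summable_iff_vanishing_norm]
  intro ε hε
  -- Cauchy criterion; the threshold ε²/2 absorbs the factor 2 of the Bessel-type estimate.
  obtain ⟨F, hF⟩ := summable_iff_vanishing_norm.1 hsum (ε ^ 2 / 2) (by positivity)
  refine ⟨F, fun t ht => ?_⟩
  have h1 := norm_sum_sq_le_of_inner_eq_zero hB hneg horth t
  have h2 := (le_abs_self _).trans_lt (hF t ht)
  exact lt_of_pow_lt_pow_left₀ 2 hε.le (by linarith)

/-- The preimage is the sum over all k of the decaying extensions of Re(a_k exp(iω k·x)), with a_k =
c_k/√(T^N). No term is counted twice: the waves of k and -k coincide, and each carries half of each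
coefficient. -/
theorem H_subset_range_Tr {N : ℕ} {s m T : ℝ} (hs0 : 0 < s) (hs1 : s < 1) (hm : 0 < m)
    (hT : 0 < T) : H N s m T ⊆ range (Tr N s m T hs0 hs1 hm) := by
  intro u hu
  have hr : (0 : ℝ) < √(T ^ N) := by positivity
  have hneg : ∀ k, fourierCoef u (-k) = (starRingEnd ℂ) (fourierCoef u k) := fun k => by
    simp only [fourierCoef_eq_coef, coef_neg_ofReal]
  let a : (Fin N → ℤ) → ℂ := fun k => fourierCoef u k / (√(T ^ N) : ℂ)
  have ha : ∀ k, ‖a k‖ ^ 2 = (√(T ^ N))⁻¹ ^ 2 * ‖fourierCoef u k‖ ^ 2 := fun k => by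
    simp only [a, norm_div, Complex.norm_real, Real.norm_eq_abs, abs_of_pos hr]
    field_simp
  let g : (Fin N → ℤ) → X N s m T := fun k => (testWave hs1 hm hT k (a k) : TestFun N s m T)
  let K : ℝ := 2 * (cellMeasure N T).real univ *
    (Real.Gamma (2 - 2 * s) * (1 / 2) ^ (2 - 2 * s)) * (√(T ^ N))⁻¹ ^ 2
  have hsum : Summable g := by
    refine summable_of_inner_eq_zero (B := fun k => K * hTerm s m u k) (fun k => ?_) (fun k => ?_)
      (fun k l h1 h2 => ?_) (Summable.mul_left K hu)
    · simp only [g, UniformSpace.Completion.norm_coe]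
      refine (norm_sq_testWave_le hs1 hm hT k (a k)).trans (le_of_eq ?_)
      rw [ha, hTerm_eq]
      ring
    · simp only [hTerm_eq, symb_neg, hneg, RCLike.norm_conj]
    · simp only [g, UniformSpace.Completion.inner_coe]
      exact inner_testWave_eq_zero hs1 hm hT _ _ h1 h2
  refine ⟨∑' k, g k, fourierCoef_injective hT fun l => ?_⟩
  have h1 := (hsum.hasSum.mapL (Tr N s m T hs0 hs1 hm)).mapL (fourierCoefCLM hT l)
  have hterm : ∀ k, fourierCoefCLM hT l (Tr N s m T hs0 hs1 hm (g k)) =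
      (if k = l then (√(T ^ N) : ℂ) * (a l / 2) else 0) +
        if k = -l then (√(T ^ N) : ℂ) * ((starRingEnd ℂ) (a (-l)) / 2) else 0 := by
    intro k
    have : (fun x => ((testWave (s := s) hs1 hm hT k (a k)).toFun (x, 0) : ℂ)) =
        fun x => (wave T k (a k) x : ℂ) := by
      ext x; simp [toFun_testWave, decayingWave]
    rw [fourierCoefCLM_apply, fourierCoef_Tr_coe, this, coef_wave hT]
    congr 1
    · split_ifs with h
      · rw [h]
      · rfl
    · split_ifs with h
      · rw [h]
      · rfl
  simp_rw [hterm] at h1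
  -- The coefficient at l receives c_l/2 from k = l and, by the reality condition, another c_l/2
  -- from k = -l.
  have h2 := (hasSum_ite_eq l ((√(T ^ N) : ℂ) * (a l / 2))).add
    (hasSum_ite_eq (-l) ((√(T ^ N) : ℂ) * ((starRingEnd ℂ) (a (-l)) / 2)))
  have h3 := h1.unique h2
  rw [fourierCoefCLM_apply] at h3
  rw [h3]
  simp only [a, hneg, map_div₀, Complex.conj_conj, Complex.conj_ofReal]
  have : (√(T ^ N) : ℂ) ≠ 0 := by exact_mod_cast hr.ne'
  field_simp
  ring

/-! ### Counting lattice points below a frequency threshold -/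

/-- The ball ω|k| ≤ √R is enclosed in a cube, whose lattice points are easy to count. -/
theorem mem_piFinset_of_symb_le {N : ℕ} (m : ℝ) {T : ℝ} (hT : 0 < T) {R : ℝ}
    {k : Fin N → ℤ} (hk : symb m T k ≤ R) :
    k ∈ Fintype.piFinset fun _ : Fin N =>
      Finset.Icc (-(⌊√R / (2 * Real.pi / T)⌋₊ : ℤ)) ⌊√R / (2 * Real.pi / T)⌋₊ := by
  have hω : 0 < 2 * Real.pi / T := by positivity
  rw [Fintype.mem_piFinset]
  intro i
  rw [Finset.mem_Icc, ← abs_le]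
  have h1 : (k i : ℝ) ^ 2 ≤ ∑ i, (k i : ℝ) ^ 2 :=
    Finset.single_le_sum (f := fun i => (k i : ℝ) ^ 2) (fun i _ => sq_nonneg _) (Finset.mem_univ i)
  have h2 : (2 * Real.pi / T * |(k i : ℝ)|) ^ 2 ≤ R := by
    rw [mul_pow, sq_abs]
    unfold symb at hk
    nlinarith [mul_le_mul_of_nonneg_left h1 (sq_nonneg (2 * Real.pi / T)), sq_nonneg m]
  have h3 : |(k i : ℝ)| ≤ √R / (2 * Real.pi / T) := by
    rw [le_div_iff₀ hω, mul_comm]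
    exact Real.le_sqrt_of_sq_le h2
  have h4 : (k i).natAbs ≤ ⌊√R / (2 * Real.pi / T)⌋₊ := by
    refine Nat.le_floor ?_
    rwa [Nat.cast_natAbs, Int.cast_abs]
  rw [Int.abs_eq_natAbs]
  exact_mod_cast h4

theorem finite_symb_le {N : ℕ} (m : ℝ) {T : ℝ} (hT : 0 < T) (R : ℝ) :
    {k : Fin N → ℤ | symb m T k ≤ R}.Finite :=
  (Finset.finite_toSet _).subset fun _ hk => mem_piFinset_of_symb_le m hT hk

theorem exists_card_symb_le (N : ℕ) {m T : ℝ} (hm : 0 < m) (hT : 0 < T) :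
    ∃ C : ℝ, 0 < C ∧ ∀ R : ℝ, 0 < R → ∀ F : Finset (Fin N → ℤ), (∀ k ∈ F, symb m T k ≤ R) →
      (F.card : ℝ) ≤ C * R ^ ((N : ℝ) / 2) := by
  have hω : 0 < 2 * Real.pi / T := by positivity
  refine ⟨(2 / (2 * Real.pi / T) + 1 / m) ^ N, by positivity, fun R hR F hF => ?_⟩
  rcases F.eq_empty_or_nonempty with rfl | ⟨k, hk⟩
  · simp only [Finset.card_empty, Nat.cast_zero]; positivity
  -- A nonempty F forces R ≥ m², so the 1 in the count 2⌊√R/ω⌋ + 1 is at most √R/m. This is where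
  -- 1/m in the constant comes from.
  have hmR : m ≤ √R := Real.le_sqrt_of_sq_le ((sq_le_symb m T k).trans (hF k hk))
  have h1 : F.card ≤ (2 * ⌊√R / (2 * Real.pi / T)⌋₊ + 1) ^ N := by
    refine (Finset.card_le_card fun k hk => mem_piFinset_of_symb_le m hT (hF k hk)).trans ?_
    simp only [Fintype.card_piFinset, Int.card_Icc, Finset.prod_const, Finset.card_univ,
      Fintype.card_fin]
    exact Nat.pow_le_pow_left (by omega) N
  have h2 : R ^ ((N : ℝ) / 2) = √R ^ N := by
    rw [Real.sqrt_eq_rpow, ← Real.rpow_natCast, ← Real.rpow_mul hR.le]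
    congr 1; ring
  rw [h2, ← mul_pow]
  refine (Nat.cast_le.2 h1).trans ?_
  push_cast
  refine pow_le_pow_left₀ (by positivity) ?_ N
  have h3 := Nat.floor_le (show 0 ≤ √R / (2 * Real.pi / T) by positivity)
  have h4 : 1 ≤ 1 / m * √R := by rw [one_div_mul_eq_div, one_le_div hm]; exact hmR
  have h5 : 2 / (2 * Real.pi / T) * √R = 2 * (√R / (2 * Real.pi / T)) := by ring
  linarith

/-- The low modes satisfy `∑_{λ_k² ≤ R} λ_k^{-2s} ≤ K R^{N/2 - s}`. -/
theorem exists_sum_symb_rpow_neg_le (N : ℕ) {s m T : ℝ} (hs0 : 0 < s) (hm : 0 < m) (hT : 0 < T)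
    (hN : 2 * s < N) :
    ∃ K : ℝ, 0 < K ∧ ∀ R : ℝ, 0 < R → ∀ F : Finset (Fin N → ℤ), (∀ k ∈ F, symb m T k ≤ R) →
      ∑ k ∈ F, symb m T k ^ (-s) ≤ K * R ^ ((N : ℝ) / 2 - s) := by
  obtain ⟨C, hC, hcard⟩ := exists_card_symb_le N hm hT
  set r : ℝ := (N : ℝ) / 2 - s with hr
  have hr0 : 0 < r := by rw [hr]; linarith
  have hq1 : (1 / 2 : ℝ) ^ r < 1 := Real.rpow_lt_one (by norm_num) (by norm_num) hr0
  have hq : 0 < 1 - (1 / 2 : ℝ) ^ r := by linarith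
  have h2s : (0 : ℝ) < 2 ^ s := Real.rpow_pos_of_pos two_pos s
  -- K is the fixed point of the recursion K·2^{-r} + C·2^s = K, which the dyadic step below
  -- reproduces.
  set K := C * 2 ^ s / (1 - (1 / 2 : ℝ) ^ r) with hK
  have hK0 : 0 < K := by positivity
  have hKeq : K * (1 / 2 : ℝ) ^ r + C * 2 ^ s = K := by rw [hK]; field_simp; ring
  -- Induction on the number of dyadic scales between m² and R. For n = 0 there are no modes at all,
  -- because λ_k² ≥ m².
  have key : ∀ n : ℕ, ∀ R : ℝ, 0 < R → R < m ^ 2 * 2 ^ n → ∀ F : Finset (Fin N → ℤ),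
      (∀ k ∈ F, symb m T k ≤ R) → ∑ k ∈ F, symb m T k ^ (-s) ≤ K * R ^ r := by
    intro n
    induction n with
    | zero =>
      intro R hR hRm F hF
      have : F = ∅ := Finset.eq_empty_of_forall_notMem fun k hk => by
        have := sq_le_symb m T k
        linarith [hF k hk]
      rw [this, Finset.sum_empty]
      positivity
    | succ n ih =>
      intro R hR hRm F hF
      -- The modes up to R/2 fall under the induction hypothesis. The shell above has at most C
      -- R^{N/2} modes, each of weight at most (R/2)^{-s}.
      rw [← Finset.sum_filter_add_sum_filter_not F fun k => symb m T k ≤ R / 2]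
      have h1 := ih (R / 2) (by positivity) (by rw [pow_succ 2 n] at hRm; linarith)
        (F.filter fun k => symb m T k ≤ R / 2) fun k hk => (Finset.mem_filter.1 hk).2
      have h2 : ∑ k ∈ F.filter (fun k => ¬ symb m T k ≤ R / 2), symb m T k ^ (-s) ≤
          C * 2 ^ s * R ^ r := by
        have hle : ∀ k ∈ F.filter (fun k => ¬ symb m T k ≤ R / 2),
            symb m T k ^ (-s) ≤ (R / 2) ^ (-s) := fun k hk =>
          Real.rpow_le_rpow_of_nonpos (by positivity)
            (not_le.1 (Finset.mem_filter.1 hk).2).le (by linarith)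
        refine (Finset.sum_le_card_nsmul _ _ _ hle).trans ?_
        rw [nsmul_eq_mul]
        refine (mul_le_mul_of_nonneg_right (hcard R hR _ fun k hk =>
          hF k (Finset.mem_filter.1 hk).1) (by positivity)).trans (le_of_eq ?_)
        rw [hr, Real.rpow_sub hR, Real.div_rpow hR.le two_pos.le, Real.rpow_neg hR.le,
          Real.rpow_neg two_pos.le]
        field_simp
      have h3 : K * (R / 2) ^ r = K * (1 / 2 : ℝ) ^ r * R ^ r := by
        rw [div_eq_mul_one_div, Real.mul_rpow hR.le (by norm_num)]; ring
      rw [h3] at h1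
      calc _ ≤ K * (1 / 2 : ℝ) ^ r * R ^ r + C * 2 ^ s * R ^ r := add_le_add h1 h2
        _ = K * R ^ r := by rw [← add_mul, hKeq]
  refine ⟨K, hK0, fun R hR F hF => ?_⟩
  obtain ⟨n, hn⟩ := pow_unbounded_of_one_lt (R / m ^ 2) (one_lt_two (α := ℝ))
  refine key n R hR ?_ F hF
  rwa [div_lt_iff₀ (by positivity), mul_comm] at hn

/-! ### The critical Sobolev inequality -/

/-- If the modes in `F` contribute at most `t / 2`, then the remaining ones control the
distribution function at height `t`. -/
theorem measure_lt_abs_le {N : ℕ} {T : ℝ} (hT : 0 < T) (u : Lp ℝ 2 (cellMeasure N T))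
    (F : Finset (Fin N → ℤ)) {t : ℝ} (ht : 0 < t)
    (hF : ∑ k ∈ F, ‖fourierCoef u k‖ / √(T ^ N) ≤ t / 2) :
    cellMeasure N T {x | t < |u x|} ≤ ENNReal.ofReal (4 / t ^ 2) *
      ∑' k, (if k ∈ F then 0 else ENNReal.ofReal (‖fourierCoef u k‖ ^ 2)) := by
  have hr : (0 : ℝ) < √(T ^ N) := by positivity
  have hrc : (√(T ^ N) : ℂ) ≠ 0 := by exact_mod_cast hr.ne'
  -- The low-frequency part of u. It is taken complex-valued, since F is not assumed symmetric under
  -- k ↦ -k.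
  let w : EuclideanSpace ℝ (Fin N) → ℂ := fun x =>
    ∑ k ∈ F, fourierCoef u k / (√(T ^ N) : ℂ) * expMode T k x
  have hwc : Continuous w := continuous_finsetSum _ fun k _ =>
    continuous_const.mul (continuous_expMode T k)
  have hw : ∀ x, ‖w x‖ ≤ t / 2 := fun x => by
    refine (norm_sum_le _ _).trans (le_trans (Finset.sum_le_sum fun k _ => ?_) hF)
    rw [norm_mul, norm_expMode, mul_one, norm_div, Complex.norm_real, Real.norm_eq_abs,
      abs_of_pos hr]
  let h : EuclideanSpace ℝ (Fin N) → ℂ := fun x => (u x : ℂ) - w x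
  have hh : MemLp h 2 (cellMeasure N T) :=
    ((Lp.memLp u).ofReal (K := ℂ)).sub (memLp_of_continuous hwc 2)
  have hwi : Integrable w (cellMeasure N T) := integrable_of_continuous hwc
  have hcoef : ∀ k, coef T h k = if k ∈ F then 0 else fourierCoef u k := by
    intro k
    have h1 : coef T w k = if k ∈ F then fourierCoef u k else 0 := by
      rw [coef_sum F fun j _ => (integrable_expMode T j).const_mul _]
      simp_rw [coef_const_mul, coef_expMode hT, mul_ite, mul_zero, div_mul_cancel₀ _ hrc]
      rw [Finset.sum_ite_eq']
    rw [coef_sub (integrable_coe u) hwi, h1, fourierCoef_eq_coef]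
    split_ifs <;> simp
  have hpars := hasSum_sq_coef hT hh
  have hsum : ∑' k, (if k ∈ F then 0 else ENNReal.ofReal (‖fourierCoef u k‖ ^ 2)) =
      ENNReal.ofReal (∫ x, ‖h x‖ ^ 2 ∂(cellMeasure N T)) := by
    rw [← hpars.tsum_eq, ENNReal.ofReal_tsum_of_nonneg (fun k => sq_nonneg _) hpars.summable]
    refine tsum_congr fun k => ?_
    rw [hcoef]
    split_ifs <;> simp
  have hint : Integrable (fun x => ‖h x‖ ^ 2) (cellMeasure N T) := hh.integrable_norm_pow two_ne_zero
  rw [hsum]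
  -- As |w| ≤ t/2, the high-frequency remainder h has modulus at least t/2 wherever |u| > t.
  -- Chebyshev's inequality and Parseval for h finish the estimate.
  have hsub : {x | t < |u x|} ⊆ {x | (t / 2) ^ 2 ≤ ‖h x‖ ^ 2} := by
    intro x (hx : t < |u x|)
    have h1 : |u x| ≤ ‖h x‖ + ‖w x‖ := by
      have : (u x : ℂ) = h x + w x := by simp [h]
      rw [← Real.norm_eq_abs, ← Complex.norm_real, this]
      exact norm_add_le _ _
    have h2 : t / 2 ≤ ‖h x‖ := by linarith [hw x]
    exact pow_le_pow_left₀ (by positivity) h2 2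
  refine (measure_mono hsub).trans ?_
  have hmark := mul_meas_ge_le_integral_of_nonneg (ae_of_all _ fun x => sq_nonneg ‖h x‖) hint
    ((t / 2) ^ 2)
  have hfin : cellMeasure N T {x | (t / 2) ^ 2 ≤ ‖h x‖ ^ 2} ≠ ⊤ := measure_ne_top _ _
  rw [← ofReal_measureReal hfin, ← ENNReal.ofReal_mul (by positivity)]
  refine ENNReal.ofReal_le_ofReal ?_
  have e : (t / 2) ^ 2 = (4 / t ^ 2)⁻¹ := by field_simp; norm_num
  rw [← div_le_iff₀' (by positivity), div_eq_inv_mul, ← e]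
  exact hmark

/-- The exponent p - 3 combines t^{p-1} from the layer-cake formula with t^{-2} from Chebyshev; a
mode counts as high only for t < b. Convergence at 0 is where p > 2 enters. -/
theorem lintegral_rpow_sub_three {p b : ℝ} (hp : 2 < p) (hb : 0 ≤ b) :
    ∫⁻ t in Ioi (0 : ℝ), (if b ≤ t then 0 else ENNReal.ofReal (t ^ (p - 3))) =
      ENNReal.ofReal (b ^ (p - 2) / (p - 2)) := by
  have h1 : ∫⁻ t in Ioi (0 : ℝ), (if b ≤ t then 0 else ENNReal.ofReal (t ^ (p - 3))) =
      ∫⁻ t in Ioo 0 b, ENNReal.ofReal (t ^ (p - 3)) := by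
    rw [← lintegral_indicator measurableSet_Ioi, ← lintegral_indicator measurableSet_Ioo]
    refine lintegral_congr fun t => ?_
    by_cases h0 : 0 < t <;> by_cases hbt : b ≤ t <;> simp [indicator, h0, hbt, not_lt]
  have hint : IntervalIntegrable (fun t : ℝ => t ^ (p - 3)) volume 0 b :=
    intervalIntegral.intervalIntegrable_rpow' (by linarith)
  rw [h1, restrict_Ioo_eq_restrict_Ioc, ← ofReal_integral_eq_lintegral_ofReal
    ((intervalIntegrable_iff_integrableOn_Ioc_of_le hb).1 hint)
    ((ae_restrict_iff' measurableSet_Ioc).2 (ae_of_all _ fun y hy => Real.rpow_nonneg hy.1.le _)),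
    ← intervalIntegral.integral_of_le hb, integral_rpow (Or.inl (by linarith)),
    Real.zero_rpow (by linarith), sub_zero]
  congr 2 <;> ring_nf

/-- The modes below height `t`, chosen so that their contribution is at most `t / 2`. -/
theorem measure_lt_abs_le_tsum {N : ℕ} {s m T : ℝ} (hm : 0 < m) (hT : 0 < T)
    (hN : 2 * s < N) {K : ℝ} (hK : 0 < K)
    (hKsum : ∀ R : ℝ, 0 < R → ∀ F : Finset (Fin N → ℤ), (∀ k ∈ F, symb m T k ≤ R) →
      ∑ k ∈ F, symb m T k ^ (-s) ≤ K * R ^ ((N : ℝ) / 2 - s))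
    {u : Lp ℝ 2 (cellMeasure N T)} (hu : u ∈ H N s m T) {M : ℝ} (hM : 0 < M)
    (huM : hNorm s m u ≤ M) {t : ℝ} (ht : 0 < t) :
    cellMeasure N T {x | t < |u x|} ≤ ENNReal.ofReal (4 / t ^ 2) *
      ∑' k, (if 2 * √K / √(T ^ N) * M * symb m T k ^ (((N : ℝ) / 2 - s) / 2) ≤ t then 0 else
        ENNReal.ofReal (‖fourierCoef u k‖ ^ 2)) := by
  classical
  have hr : (0 : ℝ) < √(T ^ N) := by positivity
  set r : ℝ := (N : ℝ) / 2 - s with hrdef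
  have hr0 : 0 < r := by rw [hrdef]; linarith
  -- B and R are tuned so that K R^r M² = (t √(T^N)/2)², which is exactly what Cauchy–Schwarz needs
  -- for a low part of size t/2.
  set B : ℝ := 2 * √K / √(T ^ N) * M with hB
  have hB0 : 0 < B := by positivity
  set R : ℝ := (t / B) ^ (2 / r) with hR
  have hR0 : 0 < R := by positivity
  have hRr : R ^ r = (t / B) ^ 2 := by
    rw [hR, ← Real.rpow_mul (by positivity), div_mul_cancel₀ _ hr0.ne', Real.rpow_two]
  -- The cutoff λ_k² ≤ R(t), rewritten as a lower bound on t for fixed k, so that the t-integral can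
  -- later be taken inside the sum over k.
  have hiff : ∀ k : Fin N → ℤ, B * symb m T k ^ (r / 2) ≤ t ↔ symb m T k ≤ R := by
    intro k
    have hs := symb_pos hm T k
    rw [← le_div_iff₀' hB0, hR, ← Real.rpow_le_rpow_iff (z := 2 / r)
      (Real.rpow_nonneg hs.le _) (by positivity) (by positivity), ← Real.rpow_mul hs.le]
    have : r / 2 * (2 / r) = 1 := by field_simp
    rw [this, Real.rpow_one]
  set F : Finset (Fin N → ℤ) := (finite_symb_le m hT R).toFinset with hF
  have hmem : ∀ k, k ∈ F ↔ symb m T k ≤ R := fun k => by simp [hF]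
  -- Cauchy–Schwarz, writing |c_k| as λ_k^{-s} times λ_k^s|c_k|.
  have hcs : (∑ k ∈ F, ‖fourierCoef u k‖) ^ 2 ≤ (K * (t / B) ^ 2) * M ^ 2 := by
    have h1 := Finset.sum_mul_sq_le_sq_mul_sq F (fun k => √(symb m T k ^ (-s)))
      (fun k => √(hTerm s m u k))
    have h2 : ∀ k, √(symb m T k ^ (-s)) * √(hTerm s m u k) = ‖fourierCoef u k‖ := fun k => by
      have hs := symb_pos hm T k
      rw [← Real.sqrt_mul (Real.rpow_nonneg hs.le _), hTerm_eq, ← mul_assoc,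
        ← Real.rpow_add hs, neg_add_cancel, Real.rpow_zero, one_mul, Real.sqrt_sq (norm_nonneg _)]
    simp_rw [h2, Real.sq_sqrt (Real.rpow_nonneg (symb_pos hm T _).le (-s)),
      Real.sq_sqrt (hTerm_nonneg hm u _)] at h1
    have h3 := hKsum R hR0 F fun k hk => (hmem k).1 hk
    rw [hRr] at h3
    have h4 : ∑ k ∈ F, hTerm s m u k ≤ M ^ 2 := by
      refine (hu.sum_le_tsum F fun k _ => hTerm_nonneg hm u k).trans ?_
      rw [← Real.sq_sqrt (tsum_nonneg fun k => hTerm_nonneg hm u k)]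
      exact pow_le_pow_left₀ (Real.sqrt_nonneg _) huM 2
    exact h1.trans (mul_le_mul h3 h4 (Finset.sum_nonneg fun k _ => hTerm_nonneg hm u k)
      (by positivity))
  have hlow : ∑ k ∈ F, ‖fourierCoef u k‖ / √(T ^ N) ≤ t / 2 := by
    rw [← Finset.sum_div, div_le_iff₀ hr]
    have he : K * (t / B) ^ 2 * M ^ 2 = (t / 2 * √(T ^ N)) ^ 2 := by
      have hKs : √K ^ 2 = K := Real.sq_sqrt hK.le
      have hKs0 : √K ≠ 0 := (Real.sqrt_pos.2 hK).ne'
      nth_rewrite 1 [← hKs]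
      rw [hB]
      field_simp
    rw [he] at hcs
    exact le_of_sq_le_sq hcs (by positivity)
  have h := measure_lt_abs_le hT u F ht hlow
  refine h.trans (le_of_eq ?_)
  congr 1
  refine tsum_congr fun k => ?_
  simp only [hmem, hiff]

/-- The fractional Sobolev inequality at the critical exponent `2N/(N-2s)`. -/
theorem exists_lintegral_rpow_le (N : ℕ) {s m T : ℝ} (hs0 : 0 < s) (hm : 0 < m) (hT : 0 < T)
    (hN : 2 * s < N) {p : ℝ} (hp : p = 2 * N / (N - 2 * s)) :
    ∃ C : ℝ, 0 < C ∧ ∀ u ∈ H N s m T, ∀ M : ℝ, 0 < M → hNorm s m u ≤ M →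
      ∫⁻ x, ENNReal.ofReal (|u x| ^ p) ∂(cellMeasure N T) ≤ ENNReal.ofReal (C * M ^ p) := by
  obtain ⟨K, hK, hKsum⟩ := exists_sum_symb_rpow_neg_le N hs0 hm hT hN
  have hr : (0 : ℝ) < √(T ^ N) := by positivity
  have hd : 0 < (N : ℝ) - 2 * s := by linarith
  have hp2 : 2 < p := by rw [hp, lt_div_iff₀ hd]; linarith
  set B : ℝ := 2 * √K / √(T ^ N) with hB
  have hB0 : 0 < B := by positivity
  refine ⟨p * 4 * (B ^ (p - 2) / (p - 2)), by have : 0 < p - 2 := by linarith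
                                              positivity, fun u hu M hM huM => ?_⟩
  set b : (Fin N → ℤ) → ℝ := fun k => B * M * symb m T k ^ (((N : ℝ) / 2 - s) / 2) with hb
  have hb0 : ∀ k, 0 ≤ b k := fun k =>
    mul_nonneg (by positivity) (Real.rpow_nonneg (symb_pos hm T k).le _)
  have hmeas : AEMeasurable (fun x => |u x|) (cellMeasure N T) :=
    (Lp.memLp u).1.aemeasurable.abs
  -- Layer-cake formula: the p-th power integral is p ∫ |{|u| > t}| t^{p-1} dt.
  rw [lintegral_rpow_eq_lintegral_meas_lt_mul _ (ae_of_all _ fun x => abs_nonneg _) hmeas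
    (by linarith)]
  have hstep : ∀ t ∈ Ioi (0 : ℝ), cellMeasure N T {x | t < |u x|} * ENNReal.ofReal (t ^ (p - 1)) ≤
      ∑' k, ENNReal.ofReal (4 * ‖fourierCoef u k‖ ^ 2) *
        (if b k ≤ t then 0 else ENNReal.ofReal (t ^ (p - 3))) := by
    intro t ht
    have ht0 : 0 < t := ht
    refine (mul_le_mul_left (measure_lt_abs_le_tsum hm hT hN hK hKsum hu hM huM ht0) _).trans
      (le_of_eq ?_)
    rw [mul_right_comm, ← ENNReal.tsum_mul_left]
    refine tsum_congr fun k => ?_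
    by_cases h : b k ≤ t
    · rw [if_pos h, if_pos h, mul_zero, mul_zero]
    · rw [if_neg h, if_neg h, ← ENNReal.ofReal_mul (by positivity),
        ← ENNReal.ofReal_mul (by positivity), ← ENNReal.ofReal_mul (by positivity)]
      congr 1
      have e : t ^ (p - 1) = t ^ (p - 3) * t ^ 2 := by
        rw [← Real.rpow_natCast t 2, ← Real.rpow_add ht0]; congr 1; push_cast; ring
      rw [e]
      field_simp
  have hmk : ∀ k, Measurable fun t : ℝ => if b k ≤ t then 0 else ENNReal.ofReal (t ^ (p - 3)) :=
    fun k => Measurable.ite measurableSet_Ici measurable_const (by fun_prop)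
  refine (mul_le_mul_right (setLIntegral_mono' measurableSet_Ioi hstep) _).trans ?_
  rw [lintegral_tsum fun k => ((hmk k).const_mul _).aemeasurable]
  simp_rw [lintegral_const_mul _ (hmk _), lintegral_rpow_sub_three hp2 (hb0 _)]
  -- Criticality of p is used here: (N/2 - s)/2 · (p - 2) = s, so the integration in t returns
  -- precisely the weight of H.
  have hpow : ∀ k, b k ^ (p - 2) = (B * M) ^ (p - 2) * symb m T k ^ s := by
    intro k
    rw [hb]
    simp only
    rw [Real.mul_rpow (by positivity) (Real.rpow_nonneg (symb_pos hm T k).le _),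
      ← Real.rpow_mul (symb_pos hm T k).le]
    congr 2
    rw [hp]
    field_simp
    ring
  have hp20 : 0 < p - 2 := by linarith
  have hterm : ∀ k, ENNReal.ofReal (4 * ‖fourierCoef u k‖ ^ 2) *
      ENNReal.ofReal (b k ^ (p - 2) / (p - 2)) =
      ENNReal.ofReal (4 * ((B * M) ^ (p - 2) / (p - 2)) * hTerm s m u k) := fun k => by
    rw [← ENNReal.ofReal_mul (by positivity), hpow, hTerm_eq]
    congr 1
    ring
  simp_rw [hterm]
  rw [← ENNReal.ofReal_tsum_of_nonneg (fun k => mul_nonneg (by positivity) (hTerm_nonneg hm u k))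
    (Summable.mul_left _ hu), tsum_mul_left, ← ENNReal.ofReal_mul (by linarith)]
  refine ENNReal.ofReal_le_ofReal ?_
  have hsq : ∑' k, hTerm s m u k ≤ M ^ 2 := by
    rw [← Real.sq_sqrt (tsum_nonneg fun k => hTerm_nonneg hm u k)]
    exact pow_le_pow_left₀ (Real.sqrt_nonneg _) huM 2
  have hMp : M ^ p = M ^ (p - 2) * M ^ 2 := by
    rw [← Real.rpow_natCast M 2, ← Real.rpow_add hM]; congr 1; push_cast; ring
  rw [hMp, Real.mul_rpow hB0.le hM.le]
  calc p * (4 * (B ^ (p - 2) * M ^ (p - 2) / (p - 2)) * ∑' k, hTerm s m u k)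
      ≤ p * (4 * (B ^ (p - 2) * M ^ (p - 2) / (p - 2)) * M ^ 2) := by gcongr
    _ = p * 4 * (B ^ (p - 2) / (p - 2)) * (M ^ (p - 2) * M ^ 2) := by ring

theorem exists_eLpNorm_critical_le (N : ℕ) {s m T : ℝ} (hs0 : 0 < s) (hm : 0 < m) (hT : 0 < T)
    (hN : 2 * s < N) :
    ∃ C : ℝ, 0 < C ∧ ∀ u ∈ H N s m T,
      eLpNorm u (ENNReal.ofReal (2 * N / (N - 2 * s))) (cellMeasure N T) ≤
        ENNReal.ofReal (C * hNorm s m u) := by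
  set p : ℝ := 2 * N / (N - 2 * s) with hp
  have hd : 0 < (N : ℝ) - 2 * s := by linarith
  have hp0 : 0 < p := by
    have : 2 < p := by rw [hp, lt_div_iff₀ hd]; linarith
    linarith
  obtain ⟨C, hC, h⟩ := exists_lintegral_rpow_le N hs0 hm hT hN hp
  refine ⟨C ^ (1 / p), by positivity, fun u hu => ?_⟩
  have hpos : ∀ M : ℝ, 0 < M → hNorm s m u ≤ M →
      eLpNorm u (ENNReal.ofReal p) (cellMeasure N T) ≤ ENNReal.ofReal (C ^ (1 / p) * M) := by
    intro M hM huM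
    rw [eLpNorm_eq_lintegral_rpow_enorm_toReal (by simpa using hp0) ENNReal.ofReal_ne_top,
      ENNReal.toReal_ofReal hp0.le, one_div, ENNReal.rpow_inv_le_iff hp0,
      ENNReal.ofReal_rpow_of_nonneg (by positivity) hp0.le,
      Real.mul_rpow (by positivity) hM.le, ← Real.rpow_mul hC.le, inv_mul_cancel₀ hp0.ne',
      Real.rpow_one]
    refine le_trans (le_of_eq (lintegral_congr fun x => ?_)) (h u hu M hM huM)
    rw [Real.enorm_eq_ofReal_abs, ENNReal.ofReal_rpow_of_nonneg (abs_nonneg _) hp0.le]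
  have h0 : 0 ≤ hNorm s m u := Real.sqrt_nonneg _
  -- The bound requires M > 0. It is applied with M = `hNorm s m u` + ε and ε → 0, which also covers
  -- vanishing norm.
  have hlim : Tendsto (fun ε : ℝ => ENNReal.ofReal (C ^ (1 / p) * (hNorm s m u + ε))) (𝓝[>] 0)
      (𝓝 (ENNReal.ofReal (C ^ (1 / p) * hNorm s m u))) := by
    have : Continuous fun ε : ℝ => ENNReal.ofReal (C ^ (1 / p) * (hNorm s m u + ε)) :=
      ENNReal.continuous_ofReal.comp (by fun_prop)
    simpa using (this.tendsto 0).mono_left nhdsWithin_le_nhds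
  refine ge_of_tendsto hlim ?_
  filter_upwards [self_mem_nhdsWithin] with ε (hε : 0 < ε)
  exact hpos _ (by linarith) (by linarith)

theorem exists_eLpNorm_le (N : ℕ) {s m T : ℝ} (hs0 : 0 < s) (hm : 0 < m) (hT : 0 < T)
    (hN : 2 * s < N) {q : ℝ} (hq1 : 1 ≤ q) (hq : q ≤ 2 * N / (N - 2 * s)) :
    ∃ C : ℝ, 0 < C ∧ ∀ u ∈ H N s m T,
      eLpNorm u (ENNReal.ofReal q) (cellMeasure N T) ≤ ENNReal.ofReal (C * hNorm s m u) := by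
  obtain ⟨C, hC, h⟩ := exists_eLpNorm_critical_le N hs0 hm hT hN
  set p : ℝ := 2 * N / (N - 2 * s) with hp
  have hpq : ENNReal.ofReal q ≤ ENNReal.ofReal p := ENNReal.ofReal_le_ofReal hq
  -- Hölder's factor on a finite measure space; the 1 added to it below only secures positivity of
  -- the constant.
  set V : ℝ := (cellMeasure N T).real univ ^ (1 / q - 1 / p) with hV
  refine ⟨C * (V + 1), by positivity, fun u hu => ?_⟩
  refine (eLpNorm_le_eLpNorm_mul_rpow_measure_univ hpq (Lp.memLp u).1).trans ?_
  rw [ENNReal.toReal_ofReal (by linarith), ENNReal.toReal_ofReal (by linarith)]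
  have hexp : 0 ≤ 1 / q - 1 / p := sub_nonneg.2 (one_div_le_one_div_of_le (by linarith) hq)
  have h1 : cellMeasure N T univ ^ (1 / q - 1 / p) ≤ ENNReal.ofReal (V + 1) := by
    rw [← ofReal_measureReal (measure_ne_top _ _),
      ENNReal.ofReal_rpow_of_nonneg measureReal_nonneg hexp]
    exact ENNReal.ofReal_le_ofReal (by linarith)
  refine (mul_le_mul' (h u hu) h1).trans (le_of_eq ?_)
  have h0 : 0 ≤ hNorm s m u := Real.sqrt_nonneg _
  rw [← ENNReal.ofReal_mul (mul_nonneg hC.le h0)]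
  congr 1
  ring

theorem continuouslyEmbedded_H (N : ℕ) {s m T : ℝ} (hs0 : 0 < s) (hm : 0 < m) (hT : 0 < T)
    (hN : 2 * s < N) {q : ℝ} (hq1 : 1 ≤ q) (hq : q ≤ 2 * N / (N - 2 * s)) :
    ContinuouslyEmbedded (H N s m T) (hNorm s m) q := by
  obtain ⟨C, hC, h⟩ := exists_eLpNorm_le N hs0 hm hT hN hq1 hq
  exact ⟨C, hC, fun u hu => ⟨⟨(Lp.memLp u).1, (h u hu).trans_lt ENNReal.ofReal_lt_top⟩, h u hu⟩⟩

/-! ### Compactness in L² -/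

theorem fourierCoef_sub {N : ℕ} {T : ℝ} (hT : 0 < T) (u v : Lp ℝ 2 (cellMeasure N T))
    (k : Fin N → ℤ) : fourierCoef (u - v) k = fourierCoef u k - fourierCoef v k :=
  map_sub (fourierCoefCLM hT k) u v

theorem hNorm_nonneg {N : ℕ} {T : ℝ} (s m : ℝ) (u : Lp ℝ 2 (cellMeasure N T)) :
    0 ≤ hNorm s m u :=
  Real.sqrt_nonneg _

theorem sq_hNorm {N : ℕ} {s m T : ℝ} (hm : 0 < m) (u : Lp ℝ 2 (cellMeasure N T)) :
    hNorm s m u ^ 2 = ∑' k, hTerm s m u k :=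
  Real.sq_sqrt (tsum_nonneg fun k => hTerm_nonneg hm u k)

theorem hTerm_sub_le {N : ℕ} {s m T : ℝ} (hm : 0 < m) (hT : 0 < T)
    (u v : Lp ℝ 2 (cellMeasure N T)) (k : Fin N → ℤ) :
    hTerm s m (u - v) k ≤ 2 * (hTerm s m u k + hTerm s m v k) := by
  have h := norm_sub_le (fourierCoef u k) (fourierCoef v k)
  have h2 : ‖fourierCoef u k - fourierCoef v k‖ ^ 2 ≤
      2 * (‖fourierCoef u k‖ ^ 2 + ‖fourierCoef v k‖ ^ 2) :=
    (pow_le_pow_left₀ (norm_nonneg _) h 2).trans (add_sq_le (a := ‖fourierCoef u k‖))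
  rw [hTerm_eq, hTerm_eq, hTerm_eq, fourierCoef_sub hT, ← mul_add, mul_left_comm]
  exact mul_le_mul_of_nonneg_left h2 (Real.rpow_nonneg (symb_pos hm T k).le _)

theorem sub_mem_H {N : ℕ} {s m T : ℝ} (hm : 0 < m) (hT : 0 < T)
    {u v : Lp ℝ 2 (cellMeasure N T)} (hu : u ∈ H N s m T) (hv : v ∈ H N s m T) :
    u - v ∈ H N s m T :=
  Summable.of_nonneg_of_le (fun k => hTerm_nonneg hm _ k) (hTerm_sub_le hm hT u v)
    ((Summable.add hu hv).mul_left 2)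

theorem hNorm_sub_le {N : ℕ} {s m T : ℝ} (hm : 0 < m) (hT : 0 < T)
    {u v : Lp ℝ 2 (cellMeasure N T)} (hu : u ∈ H N s m T) (hv : v ∈ H N s m T) {M : ℝ}
    (huM : hNorm s m u ≤ M) (hvM : hNorm s m v ≤ M) : hNorm s m (u - v) ≤ 2 * M := by
  have hM : 0 ≤ M := (hNorm_nonneg s m u).trans huM
  refine le_of_sq_le_sq ?_ (by positivity)
  have h1 := (sub_mem_H hm hT hu hv).tsum_le_tsum (hTerm_sub_le hm hT u v)
    ((Summable.add hu hv).mul_left 2)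
  rw [tsum_mul_left, Summable.tsum_add hu hv, ← sq_hNorm hm, ← sq_hNorm hm, ← sq_hNorm hm] at h1
  have h2 := pow_le_pow_left₀ (hNorm_nonneg s m u) huM 2
  have h3 := pow_le_pow_left₀ (hNorm_nonneg s m v) hvM 2
  nlinarith

/-- The `L²` norm is controlled by finitely many modes up to a small multiple of the `H` norm. -/
theorem sq_norm_le_sum_add {N : ℕ} {s m T : ℝ} (hs0 : 0 < s) (hm : 0 < m) (hT : 0 < T)
    {u : Lp ℝ 2 (cellMeasure N T)} (hu : u ∈ H N s m T) {R : ℝ} (hR : 0 < R)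
    {F : Finset (Fin N → ℤ)} (hF : ∀ k, symb m T k ≤ R → k ∈ F) :
    ‖u‖ ^ 2 ≤ ∑ k ∈ F, ‖fourierCoef u k‖ ^ 2 + R ^ (-s) * hNorm s m u ^ 2 := by
  classical
  rw [sq_hNorm hm]
  have h1 : HasSum (fun k => if k ∈ F then ‖fourierCoef u k‖ ^ 2 else 0)
      (∑ k ∈ F, ‖fourierCoef u k‖ ^ 2) := by
    have := hasSum_sum_of_ne_finset_zero
      (L := .unconditional _)
      (f := fun k => if k ∈ F then ‖fourierCoef u k‖ ^ 2 else 0) (s := F) fun k hk => if_neg hk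
    rwa [Finset.sum_congr rfl fun k hk => if_pos hk] at this
  refine hasSum_le (fun k => ?_) (hasSum_sq_fourierCoef hT u) (h1.add ((Summable.hasSum hu).mul_left _))
  split_ifs with hk
  · exact le_add_of_nonneg_right (mul_nonneg (by positivity) (hTerm_nonneg hm u k))
  · have hRk : R ≤ symb m T k := (not_le.1 fun h => hk (hF k h)).le
    rw [zero_add, hTerm_eq, ← mul_assoc]
    refine le_mul_of_one_le_left (sq_nonneg _) ?_
    rw [Real.rpow_neg hR.le, ← div_eq_inv_mul, one_le_div (by positivity)]
    exact Real.rpow_le_rpow hR.le hRk hs0.le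

/-- Since λ_k² ≥ m², the bound is uniform in k; it places the coefficient sequences in a fixed
product of closed discs. -/
theorem norm_fourierCoef_le {N : ℕ} {s m T : ℝ} (hs0 : 0 < s) (hm : 0 < m)
    {u : Lp ℝ 2 (cellMeasure N T)} (hu : u ∈ H N s m T) {M : ℝ} (hM : hNorm s m u ≤ M)
    (k : Fin N → ℤ) : ‖fourierCoef u k‖ ≤ √(M ^ 2 / (m ^ 2) ^ s) := by
  have hms : 0 < (m ^ 2) ^ s := by positivity
  refine Real.le_sqrt_of_sq_le ?_
  rw [le_div_iff₀ hms, mul_comm]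
  have h1 : hTerm s m u k ≤ M ^ 2 := by
    refine (hu.le_tsum k fun j _ => hTerm_nonneg hm u j).trans ?_
    rw [← sq_hNorm hm]
    exact pow_le_pow_left₀ (hNorm_nonneg s m u) hM 2
  refine le_trans ?_ h1
  rw [hTerm_eq]
  exact mul_le_mul_of_nonneg_right
    (Real.rpow_le_rpow (sq_nonneg m) (sq_le_symb m T k) hs0.le) (sq_nonneg _)

/-- **Rellich's theorem**: bounded sequences of `H` have subsequences converging in `L²`. -/
theorem exists_subseq_tendsto {N : ℕ} {s m T : ℝ} (hs0 : 0 < s) (hm : 0 < m) (hT : 0 < T)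
    {u : ℕ → Lp ℝ 2 (cellMeasure N T)} (hu : ∀ j, u j ∈ H N s m T) {M : ℝ}
    (hM : ∀ j, hNorm s m (u j) ≤ M) :
    ∃ w : Lp ℝ 2 (cellMeasure N T), ∃ φ : ℕ → ℕ, StrictMono φ ∧ Tendsto (u ∘ φ) atTop (𝓝 w) := by
  have hM0 : 0 ≤ M := (hNorm_nonneg s m (u 0)).trans (hM 0)
  -- Tychonoff in place of a diagonal argument: the product is compact and, having countably many
  -- factors, first countable, so a subsequence converges in every coefficient.
  obtain ⟨c, -, φ, hφ, hc⟩ := (isCompact_univ_pi fun _ : Fin N → ℤ =>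
    isCompact_closedBall (0 : ℂ) (√(M ^ 2 / (m ^ 2) ^ s))).tendsto_subseq
      (x := fun j k => fourierCoef (u j) k) fun j k _ => by
        rw [mem_closedBall_zero_iff]
        exact norm_fourierCoef_le hs0 hm (hu j) (hM j) k
  rw [tendsto_pi_nhds] at hc
  have hcauchy : CauchySeq (u ∘ φ) := by
    rw [Metric.cauchySeq_iff]
    intro ε hε
    have hlim : Tendsto (fun R : ℝ => R ^ (-s) * (2 * M) ^ 2) atTop (𝓝 0) := by
      simpa using (tendsto_rpow_neg_atTop hs0).mul_const ((2 * M) ^ 2)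
    -- The threshold R is fixed first, so that the tail of any difference, of H norm at most 2M,
    -- costs less than ε²/2.
    obtain ⟨R, hR, hR0⟩ := ((hlim.eventually (gt_mem_nhds (show 0 < ε ^ 2 / 2 by positivity))).and
      (eventually_gt_atTop 0)).exists
    let F : Finset (Fin N → ℤ) := (finite_symb_le m hT R).toFinset
    have hF : ∀ k, symb m T k ≤ R → k ∈ F := fun k hk => by simpa [F] using hk
    have hFlim : Tendsto (fun j => ∑ k ∈ F, ‖fourierCoef (u (φ j)) k - c k‖ ^ 2) atTop (𝓝 0) := by
      have : Tendsto (fun j => ∑ k ∈ F, ‖fourierCoef (u (φ j)) k - c k‖ ^ 2) atTop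
          (𝓝 (∑ k ∈ F, ‖c k - c k‖ ^ 2)) :=
        tendsto_finsetSum _ fun k _ => (((hc k).sub_const (c k)).norm.pow 2)
      simpa using this
    -- Comparison with the limit c doubles the two sums, so ε²/8 for each leaves ε²/2 for the low
    -- modes.
    obtain ⟨n, hn⟩ := eventually_atTop.1
      (hFlim.eventually (gt_mem_nhds (show 0 < ε ^ 2 / 8 by positivity)))
    refine ⟨n, fun i hi j hj => ?_⟩
    rw [dist_eq_norm]
    refine lt_of_pow_lt_pow_left₀ 2 hε.le ?_
    have h1 := sq_norm_le_sum_add hs0 hm hT (sub_mem_H hm hT (hu (φ i)) (hu (φ j))) hR0 hF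
    have h2 : R ^ (-s) * hNorm s m (u (φ i) - u (φ j)) ^ 2 ≤ R ^ (-s) * (2 * M) ^ 2 :=
      mul_le_mul_of_nonneg_left (pow_le_pow_left₀ (hNorm_nonneg _ _ _)
        (hNorm_sub_le hm hT (hu _) (hu _) (hM _) (hM _)) 2) (by positivity)
    have h3 : ∑ k ∈ F, ‖fourierCoef (u (φ i) - u (φ j)) k‖ ^ 2 ≤
        2 * (∑ k ∈ F, ‖fourierCoef (u (φ i)) k - c k‖ ^ 2 +
          ∑ k ∈ F, ‖fourierCoef (u (φ j)) k - c k‖ ^ 2) := by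
      rw [← Finset.sum_add_distrib, Finset.mul_sum]
      refine Finset.sum_le_sum fun k _ => ?_
      rw [fourierCoef_sub hT, ← sub_sub_sub_cancel_right _ _ (c k)]
      exact (pow_le_pow_left₀ (norm_nonneg _) (norm_sub_le _ _) 2).trans add_sq_le
    have h4 := hn i hi
    have h5 := hn j hj
    simp only [Function.comp]
    linarith
  obtain ⟨w, hw⟩ := cauchySeq_tendsto_of_complete hcauchy
  exact ⟨w, φ, hφ, hw⟩

/-- Lower semicontinuity of the H norm: finite partial sums pass to the limit. It is needed because
the L^p bound is applied to the differences with w, which must therefore lie in H. -/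
theorem mem_H_of_tendsto {N : ℕ} {s m T : ℝ} (hm : 0 < m) (hT : 0 < T)
    {u : ℕ → Lp ℝ 2 (cellMeasure N T)} (hu : ∀ j, u j ∈ H N s m T) {M : ℝ}
    (hM : ∀ j, hNorm s m (u j) ≤ M) {w : Lp ℝ 2 (cellMeasure N T)}
    (hw : Tendsto u atTop (𝓝 w)) : w ∈ H N s m T ∧ hNorm s m w ≤ M := by
  have hM0 : 0 ≤ M := (hNorm_nonneg s m (u 0)).trans (hM 0)
  have hF : ∀ F : Finset (Fin N → ℤ), ∑ k ∈ F, hTerm s m w k ≤ M ^ 2 := by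
    intro F
    have hlim : Tendsto (fun j => ∑ k ∈ F, hTerm s m (u j) k) atTop
        (𝓝 (∑ k ∈ F, hTerm s m w k)) :=
      tendsto_finsetSum _ fun k _ =>
        ((((fourierCoefCLM hT k).continuous.tendsto w).comp hw).norm.pow 2).const_mul _
    refine le_of_tendsto' hlim fun j => ?_
    refine ((hu j).sum_le_tsum F fun k _ => hTerm_nonneg hm (u j) k).trans ?_
    rw [← sq_hNorm hm]
    exact pow_le_pow_left₀ (hNorm_nonneg s m (u j)) (hM j) 2
  have hmem : w ∈ H N s m T := summable_of_sum_le (fun k => hTerm_nonneg hm w k) hF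
  refine ⟨hmem, le_of_sq_le_sq ?_ hM0⟩
  rw [sq_hNorm hm]
  exact hmem.tsum_le_of_sum_le hF

/-! ### Compactness in L^q by interpolation -/

theorem lintegral_sq_eq {N : ℕ} {T : ℝ} (v : Lp ℝ 2 (cellMeasure N T)) :
    ∫⁻ x, ENNReal.ofReal (|v x| ^ (2 : ℝ)) ∂(cellMeasure N T) = ENNReal.ofReal (‖v‖ ^ 2) := by
  rw [ENNReal.ofReal_pow (norm_nonneg _), ofReal_norm, Lp.enorm_def,
    eLpNorm_eq_lintegral_rpow_enorm_toReal (by simp) (by simp)]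
  simp only [ENNReal.toReal_ofNat]
  rw [← ENNReal.rpow_natCast, ← ENNReal.rpow_mul]
  norm_num
  refine lintegral_congr fun x => ?_
  rw [Real.enorm_eq_ofReal_abs, ← ENNReal.ofReal_pow (abs_nonneg _), sq_abs]

/-- For t ≤ a the first term alone dominates, for t ≥ a the second. The free parameter a allows the
L^p term to be made small. -/
theorem rpow_le_interpolation {p q a t : ℝ} (hq2 : 2 ≤ q) (hqp : q ≤ p) (ha : 0 < a) (ht : 0 ≤ t) :
    t ^ q ≤ a ^ (q - 2) * t ^ (2 : ℝ) + a ^ (-(p - q)) * t ^ p := by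
  rcases ht.eq_or_lt with rfl | ht
  · rw [Real.zero_rpow (by linarith)]; positivity
  rcases le_total t a with h | h
  · refine le_add_of_le_of_nonneg ?_ (by positivity)
    calc t ^ q = t ^ (q - 2) * t ^ (2 : ℝ) := by rw [← Real.rpow_add ht]; ring_nf
      _ ≤ _ := mul_le_mul_of_nonneg_right (Real.rpow_le_rpow ht.le h (by linarith)) (by positivity)
  · refine le_add_of_nonneg_of_le (by positivity) ?_
    calc t ^ q = t ^ (-(p - q)) * t ^ p := by rw [← Real.rpow_add ht]; ring_nf
      _ ≤ _ := mul_le_mul_of_nonneg_right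
        (Real.rpow_le_rpow_of_nonpos ha h (by linarith)) (by positivity)

/-- Convergence in `L²` together with boundedness in `L^p` gives convergence in `L^q` for
`2 ≤ q < p`. -/
theorem tendsto_eLpNorm_of_tendsto_two {N : ℕ} {T p q : ℝ} (hq2 : 2 ≤ q) (hqp : q < p)
    {v : ℕ → Lp ℝ 2 (cellMeasure N T)} (hv : Tendsto (fun j => ‖v j‖) atTop (𝓝 0)) {D : ℝ}
    (hD : ∀ j, ∫⁻ x, ENNReal.ofReal (|v j x| ^ p) ∂(cellMeasure N T) ≤ ENNReal.ofReal D) :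
    Tendsto (fun j => eLpNorm (v j) (ENNReal.ofReal q) (cellMeasure N T)) atTop (𝓝 0) := by
  have hq0 : 0 < q := by linarith
  have hint : Tendsto (fun j => ∫⁻ x, ENNReal.ofReal (|v j x| ^ q) ∂(cellMeasure N T)) atTop
      (𝓝 0) := by
    rw [ENNReal.tendsto_nhds_zero]
    intro ε hε
    have hε2 : 0 < ε / 2 := ENNReal.half_pos hε.ne'
    -- The height a is chosen large first, making the L^p term small uniformly in j; for this a, the
    -- L² term then tends to 0.
    have hlim : Tendsto (fun a : ℝ => ENNReal.ofReal (a ^ (-(p - q)) * D)) atTop (𝓝 0) := by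
      have := ENNReal.tendsto_ofReal
        ((tendsto_rpow_neg_atTop (sub_pos.2 hqp)).mul_const D)
      simpa using this
    obtain ⟨a, ha, ha0⟩ := ((hlim.eventually (gt_mem_nhds hε2)).and (eventually_gt_atTop 0)).exists
    have hlim2 : Tendsto (fun j => ENNReal.ofReal (a ^ (q - 2) * ‖v j‖ ^ 2)) atTop (𝓝 0) := by
      have := ENNReal.tendsto_ofReal ((hv.pow 2).const_mul (a ^ (q - 2)))
      simpa using this
    filter_upwards [hlim2.eventually (gt_mem_nhds hε2)] with j hj
    have hm : AEMeasurable (fun x => |v j x|) (cellMeasure N T) :=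
      (Lp.memLp (v j)).1.aemeasurable.abs
    calc ∫⁻ x, ENNReal.ofReal (|v j x| ^ q) ∂(cellMeasure N T)
        ≤ ∫⁻ x, (ENNReal.ofReal (a ^ (q - 2)) * ENNReal.ofReal (|v j x| ^ (2 : ℝ)) +
            ENNReal.ofReal (a ^ (-(p - q))) * ENNReal.ofReal (|v j x| ^ p)) ∂(cellMeasure N T) := by
          refine lintegral_mono fun x => ?_
          rw [← ENNReal.ofReal_mul (by positivity), ← ENNReal.ofReal_mul (by positivity),
            ← ENNReal.ofReal_add (by positivity) (by positivity)]
          exact ENNReal.ofReal_le_ofReal (rpow_le_interpolation hq2 hqp.le ha0 (abs_nonneg _))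
      _ = ENNReal.ofReal (a ^ (q - 2)) * ENNReal.ofReal (‖v j‖ ^ 2) +
            ENNReal.ofReal (a ^ (-(p - q))) *
              ∫⁻ x, ENNReal.ofReal (|v j x| ^ p) ∂(cellMeasure N T) := by
          rw [lintegral_add_left' ((hm.pow_const _).ennreal_ofReal.const_mul _),
            lintegral_const_mul' _ _ ENNReal.ofReal_ne_top,
            lintegral_const_mul' _ _ ENNReal.ofReal_ne_top, lintegral_sq_eq]
      _ ≤ ε / 2 + ε / 2 := by
          refine add_le_add ?_ ?_
          · rw [← ENNReal.ofReal_mul (by positivity)]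
            exact hj.le
          · refine (mul_le_mul_right (hD j) _).trans ?_
            rw [← ENNReal.ofReal_mul (by positivity)]
            exact ha.le
      _ = ε := ENNReal.add_halves ε
  have hrpow := (ENNReal.continuous_rpow_const (y := 1 / q)).tendsto 0 |>.comp hint
  rw [ENNReal.zero_rpow_of_pos (by positivity)] at hrpow
  refine hrpow.congr fun j => ?_
  rw [eLpNorm_eq_lintegral_rpow_enorm_toReal (by simpa using hq0) ENNReal.ofReal_ne_top,
    ENNReal.toReal_ofReal hq0.le]
  simp only [Function.comp]
  congr 1
  refine lintegral_congr fun x => ?_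
  rw [Real.enorm_eq_ofReal_abs, ENNReal.ofReal_rpow_of_nonneg (abs_nonneg _) hq0.le]

theorem compactlyEmbedded_H (N : ℕ) {s m T : ℝ} (hs0 : 0 < s) (hm : 0 < m) (hT : 0 < T)
    (hN : 2 * s < N) {q : ℝ} (hq1 : 1 ≤ q) (hq : q < 2 * N / (N - 2 * s)) :
    CompactlyEmbedded (H N s m T) (hNorm s m) q := by
  have hemb := continuouslyEmbedded_H N hs0 hm hT hN hq1 hq.le
  refine ⟨hemb, fun u hu ⟨M, hM⟩ => ?_⟩
  set p : ℝ := 2 * N / (N - 2 * s) with hp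
  have hp2 : 2 < p := by rw [hp, lt_div_iff₀ (by linarith)]; linarith
  obtain ⟨w, φ, hφ, hw⟩ := exists_subseq_tendsto hs0 hm hT hu hM
  obtain ⟨hwH, hwM⟩ := mem_H_of_tendsto hm hT (u := u ∘ φ) (fun j => hu _) (fun j => hM _) hw
  obtain ⟨C, -, hC⟩ := hemb
  refine ⟨w, (hC w hwH).1, φ, hφ, ?_⟩
  have hM0 : 0 ≤ M := (hNorm_nonneg s m w).trans hwM
  obtain ⟨D, -, hD⟩ := exists_lintegral_rpow_le N hs0 hm hT hN hp
  have hv : Tendsto (fun j => ‖u (φ j) - w‖) atTop (𝓝 0) := tendsto_iff_norm_sub_tendsto_zero.1 hw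
  -- Interpolation needs an exponent at least 2, hence max q 2; smaller q follow by Hölder on the
  -- cell. The bound 2M + 1 rather than 2M keeps the radius positive even if M = 0.
  have hmain := tendsto_eLpNorm_of_tendsto_two (q := max q 2) (le_max_right _ _)
    (max_lt hq hp2) hv fun j => hD _ (sub_mem_H hm hT (hu (φ j)) hwH) (2 * M + 1) (by positivity)
      ((hNorm_sub_le hm hT (hu _) hwH (hM _) hwM).trans (by linarith))
  have hVtop : cellMeasure N T univ ^ (1 / (ENNReal.ofReal q).toReal -
      1 / (ENNReal.ofReal (max q 2)).toReal) ≠ ⊤ := by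
    rw [ENNReal.toReal_ofReal (by linarith), ENNReal.toReal_ofReal (by positivity)]
    exact ENNReal.rpow_ne_top_of_nonneg (sub_nonneg.2 (one_div_le_one_div_of_le (by linarith)
      (le_max_left _ _))) (measure_ne_top _ _)
  have hbound := ENNReal.Tendsto.mul_const hmain (Or.inr hVtop)
  rw [zero_mul] at hbound
  refine tendsto_of_tendsto_of_tendsto_of_le_of_le tendsto_const_nhds hbound (fun _ => zero_le)
    fun j => ?_
  refine (eLpNorm_congr_ae (Lp.coeFn_sub (u (φ j)) w)).symm.le.trans ?_
  exact eLpNorm_le_eLpNorm_mul_rpow_measure_univ (ENNReal.ofReal_le_ofReal (le_max_left _ _))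
    (Lp.memLp _).1

end PeriodicExt

theorem theorem4 (N : ℕ) (s m T : ℝ) (hs0 : 0 < s) (hs1 : s < 1) (hm : 0 < m) (hT : 0 < T)
    (hN : 2 * s < (N : ℝ)) :
    (Set.range (PeriodicExt.Tr N s m T hs0 hs1 hm) = PeriodicExt.H N s m T ∧
      ∃ C : ℝ, ∀ v : PeriodicExt.X N s m T,
        PeriodicExt.hNorm s m (PeriodicExt.Tr N s m T hs0 hs1 hm v) ≤ C * ‖v‖) ∧
    ∀ q : ℝ, 1 ≤ q →
      (q ≤ 2 * N / (N - 2 * s) →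
        PeriodicExt.ContinuouslyEmbedded (Set.range (PeriodicExt.Tr N s m T hs0 hs1 hm))
          (PeriodicExt.hNorm s m) q) ∧
      (q < 2 * N / (N - 2 * s) →
        PeriodicExt.CompactlyEmbedded (Set.range (PeriodicExt.Tr N s m T hs0 hs1 hm))
          (PeriodicExt.hNorm s m) q) := by
  have hrange : range (PeriodicExt.Tr N s m T hs0 hs1 hm) = PeriodicExt.H N s m T :=
    Subset.antisymm (range_subset_iff.2 (PeriodicExt.Tr_mem_H hs0 hs1 hm hT))
      (PeriodicExt.H_subset_range_Tr hs0 hs1 hm hT)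
  rw [hrange]
  exact ⟨⟨rfl, _, PeriodicExt.hNorm_Tr_le hs0 hs1 hm hT⟩, fun q hq1 =>
    ⟨fun hq => PeriodicExt.continuouslyEmbedded_H N hs0 hm hT hN hq1 hq,
      fun hq => PeriodicExt.compactlyEmbedded_H N hs0 hm hT hN hq1 hq⟩⟩
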